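/- **Setting.** Let $(A,b)$, $A=(a_{ij})\in\mathbb R^{s\times s}$, $b\in\mathbb R^s$, be a Runge--Kutta method, $c=A\mathbb 1$, $C=\mathrm{diag}(c)$. Assume that it is AS- and ASI-stable: $I-zA$ is non-singular for all $z\in\mathbb C$ with $\operatorname{Re}z\le 0$, and $(I-zA)^{-1}$ and $z\,b^T(I-zA)^{-1}$ are uniformly bounded for these $z$. Put, for $\ell\ge 1$, $$q_\ell=\frac1{\ell!}-\frac{b^Tc^{\ell-1}}{(\ell-1)!}\in\mathbb R,\qquad \sigma_\ell=\frac{c^\ell}{\ell!}-\frac{Ac^{\ell-1}}{(\ell-1)!}\in\mathbb R^s ,$$ with componentwise powers. Consider $y'(t)=Jy(t)+g(y(t))$ in $\mathbb R^N$ with an arbitrary inner product; $\mathbb R^s\otimes\mathbb R^N$ carries $\langle X,U\rangle=\sum_i\langle x_i,u_i\rangle$. For $r\ge 0$, $L>0$ and $M$ we assume that $\mu(J)=\max_{\|x\|=1}\langle x,Jx\rangle\le 0$; that $\|g(u)-g(v)\|\le L\|u-v\|$ for all $u,v\in\mathbb R^N$; that $g$ is $r$ times continuously differentiable with $\|g^{(k)}(u)\|\le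 M$ for all $u\in\mathbb R^N$, $1\le k\le r$; and that $y$ is a solution on a compact interval $\mathcal I\ni t_0$ which is $r+1$ times continuously differentiable with $\|y^{(k)}(t)\|\le M$ for $t\in\mathcal I$, $1\le k\le r+1$ (derivatives at the endpoints are one-sided). For a step size $h\ge0$ put $Z=hJ$. One step from the exact value $y(t_0)$ is given by $$Y_i=y(t_0)+h\sum_j a_{ij}\bigl(JY_j+g(Y_j)\bigr)\quad(1\le i\le s),\qquad y_1=y(t_0)+h\sum_i b_i\bigl(JY_i+g(Y_i)\bigr),$$ and the stage error and local error are $\delta Y_0=\bigl(y(t_0+c_ih)-Y_i\bigr)_{i=1}^s$ and $\delta y_1=y(t_0+h)-y_1$. **Trees.** Let $T$ be the set of (unordered) rooted trees, $|\tau|$ the number of vertices of $\tau$, and $\tau_0$ the tree with one vertex. Every $\tau\in T$ has a standardized form $\tau=[\tau_0^\ell\,\tau_1\cdots\tau_k]$ with $\ell,k\ge0$ and $\tau_i\ne\tau_0$: the subtrees attached to the root are $\ell$ copies of $\tau_0$ and $\tau_1,\dots,\tau_k$. Define $\zeta_{[\tau_0^\ell]}=1$ and, for $k\ge1$, $$\zeta_{[\tau_0^\ell\tau_1\cdots\tau_k]}=\frac{(-1)^{k+1}}{k!\,\ell!}\cdot\frac{k!}{\mu_1!\cdots\mu_p!}\,\zeta_{\tau_1}\cdots\zeta_{\tau_k},$$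 where $\mu_1,\dots,\mu_p$ are the multiplicities of the distinct trees among $\tau_1,\dots,\tau_k$. Let $\mathbf G^{(\ell,k)}(t)$ be the $k$-linear map $\frac{d^\ell}{dt^\ell}g^{(k)}(y(t))$ applied blockwise to vectors of $\mathbb R^s\otimes\mathbb R^N$. For $\tau$ with $|\tau|\le r$ and $t\in\mathcal I$ define recursively, for $\tau=[\tau_0^\ell]$, $$\Psi_\tau(Z,t)=(I-A\otimes Z)^{-1}\bigl(\sigma_{\ell+1}\otimes y^{(\ell+1)}(t)\bigr),\qquad \psi_\tau(Z,t)=q_{\ell+1}y^{(\ell+1)}(t)+(b^T\otimes Z)\Psi_\tau(Z,t),$$ and, for $\tau=[\tau_0^\ell\tau_1\cdots\tau_k]$ with $k\ge1$, $$\Psi_\tau(Z,t)=(I-A\otimes Z)^{-1}\bigl((AC^\ell)\otimes I\bigr)\,\mathbf G^{(\ell,k)}(t)\bigl(\Psi_{\tau_1}(Z,t),\dots,\Psi_{\tau_k}(Z,t)\bigr),$$ $$\psi_\tau(Z,t)=(b^T\otimes I)(I-A\otimes Z)^{-1}(C^\ell\otimes I)\,\mathbf G^{(\ell,k)}(t)\bigl(\Psi_{\tau_1}(Z,t),\dots,\Psi_{\tau_k}(Z,t)\bigr).$$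 **Theorem.** For every AS- and ASI-stable method and every $L>0$ there is $\tilde h>0$, depending only on the method and $L$, and for all $r$ and $M$ there is a constant $D$, depending only on the method, $L$, $r$ and $M$ (not on $N$, the inner product, $J$, $Z$, $g$, $y$, $t_0$, $\mathcal I$ or $h$), such that for every problem as above and every $h\in[0,\tilde h)$ with $t_0+h\in\mathcal I$ and $t_0+c_ih\in\mathcal I$ for all $i$: the matrix $I-A\otimes Z$ is non-singular, the stage equations have exactly one solution, and $$\Bigl\|\delta Y_0-\sum_{\tau\in T,\ |\tau|\le r}\zeta_\tau\,\Psi_\tau(Z,t_0)\,h^{|\tau|}\Bigr\|\le D\,h^{r+1},\qquad \Bigl\|\delta y_1-\sum_{\tau\in T,\ |\tau|\le r}\zeta_\tau\,\psi_\tau(Z,t_0)\,h^{|\tau|}\Bigr\|\le D\,h^{r+1}.$$ -/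

import Mathlib

open scoped BigOperators Nat

noncomputable section

namespace SemilinearRK

/-! ### Rooted trees -/

/-- Plane rooted trees: a vertex together with the ordered list of the subtrees attached to it. -/
inductive PlaneTree : Type
  | node : List PlaneTree → PlaneTree

namespace PlaneTree

/-- Two plane trees are equivalent if one is obtained from the other by reordering children at any
of the vertices, i.e. if they are isomorphic as (unordered) rooted trees. -/
inductive Equivalent : PlaneTree → PlaneTree → Prop
  | refl (t : PlaneTree) : Equivalent t t
  | symm {t u : PlaneTree} : Equivalent t u → Equivalent u t
  | trans {t u v : PlaneTree} : Equivalent t u → Equivalent u v → Equivalent t v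
  | perm {l l' : List PlaneTree} : l.Perm l' → Equivalent (node l) (node l')
  | child {t u : PlaneTree} (l : List PlaneTree) :
      Equivalent t u → Equivalent (node (t :: l)) (node (u :: l))

instance setoid : Setoid PlaneTree where
  r := Equivalent
  iseqv := ⟨Equivalent.refl, Equivalent.symm, Equivalent.trans⟩

/-- The subtrees attached to the root. -/
def subtrees : PlaneTree → List PlaneTree
  | node l => l

/-- The number of vertices. -/
def size : PlaneTree → ℕ
  | node l => 1 + (l.map size).sum

theorem size_eq_of_equivalent {t u : PlaneTree} (h : Equivalent t u) : t.size = u.size := by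
  induction h with
  | refl t => rfl
  | symm _ ih => exact ih.symm
  | trans _ _ ih₁ ih₂ => exact ih₁.trans ih₂
  | perm h => simp only [size]; rw [(h.map size).sum_eq]
  | child l _ ih => simp only [size, List.map_cons, List.sum_cons, ih]

theorem size_pos (t : PlaneTree) : 0 < t.size := by
  cases t; simp only [size]; omega

theorem size_lt_of_mem {t : PlaneTree} {l : List PlaneTree} (h : t ∈ l) :
    t.size < (node l).size := by
  have := List.single_le_sum (l := l.map size) (fun _ _ => Nat.zero_le _) _
    (List.mem_map_of_mem h)
  simp only [size]; omega

theorem length_lt_size (l : List PlaneTree) : l.length < (node l).size := by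
  have : l.length ≤ (l.map size).sum := by
    induction l with
    | nil => simp
    | cons a l ih => have := size_pos a; simp only [List.length_cons, List.map_cons,
        List.sum_cons]; omega
  simp only [size]; omega

theorem finite_size_le (n : ℕ) : {t : PlaneTree | t.size ≤ n}.Finite := by
  induction n with
  | zero =>
    refine Set.Finite.subset Set.finite_empty fun t ht => ?_
    have := size_pos t
    simp only [Set.mem_ofPred_eq] at ht; omega
  | succ n ih =>
    have : Finite {t : PlaneTree | t.size ≤ n} := ih
    refine Set.Finite.subset ((List.finite_length_le {t : PlaneTree | t.size ≤ n} n).image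
      fun l => node (l.map Subtype.val)) fun t ht => ?_
    obtain ⟨l⟩ := t
    simp only [Set.mem_ofPred_eq] at ht
    have hl : ∀ t ∈ l, t.size ≤ n := fun t h => by have := size_lt_of_mem h; omega
    have h2 := length_lt_size l
    refine ⟨l.attach.map fun t => ⟨t.1, hl t.1 t.2⟩, ?_, ?_⟩
    · simp only [Set.mem_ofPred_eq, List.length_map, List.length_attach]; omega
    · simp [List.map_map, Function.comp_def]

end PlaneTree

/-- Rooted trees: plane trees up to the order of the children at the vertices. -/
def RTree : Type := Quotient PlaneTree.setoid

namespace RTree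

/-- The tree `τ₀` with a single vertex. -/
def leaf : RTree := Quotient.mk PlaneTree.setoid (.node [])

/-- The number of vertices `|τ|`. -/
def order : RTree → ℕ :=
  Quotient.lift PlaneTree.size fun _ _ h => PlaneTree.size_eq_of_equivalent h

/-- The multiset of the subtrees attached to the root. -/
def children : RTree → Multiset RTree :=
  Quotient.lift
    (fun t => ((t.subtrees.map (Quotient.mk PlaneTree.setoid) : List RTree) :
      Multiset RTree))
    (by
      intro t u h
      change PlaneTree.Equivalent t u at h
      induction h with
      | refl t => rfl
      | symm _ ih => exact ih.symm
      | trans _ _ ih₁ ih₂ => exact ih₁.trans ih₂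
      | perm h => exact Multiset.coe_eq_coe.mpr (h.map _)
      | @child t u l h _ =>
        have : Quotient.mk PlaneTree.setoid t = Quotient.mk PlaneTree.setoid u := Quotient.sound h
        exact congrArg (fun x => ((x :: l.map (Quotient.mk PlaneTree.setoid) : List RTree) :
          Multiset RTree)) this)

theorem order_lt_of_mem_children {τ σ : RTree} (h : σ ∈ τ.children) : σ.order < τ.order := by
  induction τ using Quotient.inductionOn with
  | h t =>
    obtain ⟨l⟩ := t
    obtain ⟨u, hu, rfl⟩ := List.mem_map.mp (Multiset.mem_coe.mp h)
    exact PlaneTree.size_lt_of_mem hu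

theorem finite_order_le (r : ℕ) : {τ : RTree | τ.order ≤ r}.Finite := by
  refine ((PlaneTree.finite_size_le r).image (Quotient.mk PlaneTree.setoid)).subset fun τ h => ?_
  induction τ using Quotient.inductionOn with
  | h t => exact ⟨t, h, rfl⟩

/-- The finite set of all rooted trees with at most `r` vertices. -/
def upTo (r : ℕ) : Finset RTree := (finite_order_le r).toFinset

open Classical in
/-- The exponent `ℓ` in the standardized form `τ = [τ₀^ℓ τ₁ ⋯ τ_k]`: the number of children of the
root which are terminal nodes. -/
def leafCount (τ : RTree) : ℕ := τ.children.count leaf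

open Classical in
/-- The subtrees `τ₁, …, τ_k ≠ τ₀` in the standardized form `τ = [τ₀^ℓ τ₁ ⋯ τ_k]`. -/
def branches (τ : RTree) : Multiset RTree := τ.children.filter (· ≠ leaf)

theorem order_lt_of_mem_branches {τ σ : RTree} (h : σ ∈ τ.branches) : σ.order < τ.order := by
  classical
  exact order_lt_of_mem_children (Multiset.mem_of_mem_filter h)

/-- A listing `τ₁, …, τ_k` of the subtrees in the standardized form. The order of the list is
immaterial wherever it is used: the derivatives of a smooth map are symmetric multilinear maps. -/
def branchList (τ : RTree) : List RTree := τ.branches.toList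

theorem order_get_branchList_lt (τ : RTree) (j : Fin τ.branchList.length) :
    (τ.branchList.get j).order < τ.order :=
  order_lt_of_mem_branches (Multiset.mem_toList.mp (List.get_mem _ j))

open Classical in
/-- The combinatorial factor `ζ`. It is `ζ([τ₀^ℓ]) = 1` and, for `k ≥ 1`,
`ζ([τ₀^ℓ τ₁ ⋯ τ_k]) = λ_{ℓ,k} · k! / (μ₁! ⋯ μ_σ!) · ζ(τ₁) ⋯ ζ(τ_k)`, where
`λ_{ℓ,k} = (-1)^(k+1) / (k! ℓ!)` and `μ₁, …, μ_σ` are the multiplicities of the distinct trees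
among `τ₁, …, τ_k`. -/
def zeta (τ : RTree) : ℝ :=
  if τ.branches = 0 then 1
  else
    (-1 : ℝ) ^ (Multiset.card τ.branches + 1) / ((Multiset.card τ.branches)! * (τ.leafCount)!)
      * ((Multiset.card τ.branches)! / ∏ σ ∈ τ.branches.toFinset, ((τ.branches.count σ)! : ℝ))
      * (τ.branches.attach.map fun σ => zeta σ.1).prod
termination_by τ.order
decreasing_by exact order_lt_of_mem_branches σ.2

end RTree

/-! ### Runge–Kutta methods -/

/-- The coefficients `A`, `b` of a Runge–Kutta method with `s` stages. -/
structure RKMethod (s : ℕ) where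
  A : Matrix (Fin s) (Fin s) ℝ
  b : Fin s → ℝ

namespace RKMethod

variable {s : ℕ} (m : RKMethod s)

/-- The abscissae `c = A 𝟙`. -/
def c : Fin s → ℝ := fun i => ∑ j, m.A i j

/-- The matrix `I - z A` for complex `z`. -/
def oneSub (z : ℂ) : Matrix (Fin s) (Fin s) ℂ := 1 - z • m.A.map (fun x : ℝ => (x : ℂ))

/-- ASI-stability: `I - z A` is non-singular for all `z` with `Re z ≤ 0`, and `(I - z A)⁻¹` is
uniformly bounded (equivalently, its entries are) for such `z`. -/
def IsASIStable : Prop :=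
  (∀ z : ℂ, z.re ≤ 0 → IsUnit (m.oneSub z)) ∧
    ∃ K : ℝ, ∀ z : ℂ, z.re ≤ 0 → ∀ i j, ‖(m.oneSub z)⁻¹ i j‖ ≤ K

/-- AS-stability: `I - z A` is non-singular for all `z` with `Re z ≤ 0`, and `z bᵀ (I - z A)⁻¹` is
uniformly bounded (equivalently, its entries are) for such `z`. -/
def IsASStable : Prop :=
  (∀ z : ℂ, z.re ≤ 0 → IsUnit (m.oneSub z)) ∧
    ∃ K : ℝ, ∀ z : ℂ, z.re ≤ 0 → ∀ j,
      ‖z * Matrix.vecMul (fun i => (m.b i : ℂ)) (m.oneSub z)⁻¹ j‖ ≤ K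

/-- For `ℓ ≥ 1`, the scaled residual `1 / ℓ! - bᵀ c^(ℓ-1) / (ℓ-1)!`. -/
def stepResidual (ℓ : ℕ) : ℝ :=
  1 / (ℓ ! : ℝ) - (∑ i, m.b i * m.c i ^ (ℓ - 1)) / ((ℓ - 1)! : ℝ)

/-- For `ℓ ≥ 1`, the scaled residual `c^ℓ / ℓ! - A c^(ℓ-1) / (ℓ-1)!`. -/
def stageResidual (ℓ : ℕ) : Fin s → ℝ := fun i =>
  m.c i ^ ℓ / (ℓ ! : ℝ) - (∑ j, m.A i j * m.c j ^ (ℓ - 1)) / ((ℓ - 1)! : ℝ)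

end RKMethod

section Space

variable {s : ℕ} {E : Type*} [NormedAddCommGroup E] [InnerProductSpace ℝ E]

/-- The space `ℝˢ ⊗ E ≅ Eˢ` of stage vectors, with the inner product `∑ i, ⟪x i, u i⟫`. -/
abbrev Stages (s : ℕ) (E : Type*) : Type _ := PiLp 2 (fun _ : Fin s => E)

/-- The vector `β ⊗ u`. -/
def kronVec (β : Fin s → ℝ) (u : E) : Stages s E := WithLp.toLp 2 fun i => β i • u

/-- The operator `B ⊗ Z` on `ℝˢ ⊗ E`. -/
def kron (B : Matrix (Fin s) (Fin s) ℝ) (Z : E →ₗ[ℝ] E) : Module.End ℝ (Stages s E) where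
  toFun U := WithLp.toLp 2 fun i => ∑ j, B i j • Z (U j)
  map_add' U V := by
    ext i; simp [Finset.sum_add_distrib]
  map_smul' a U := by
    ext i; simp [Finset.smul_sum, smul_comm a]

/-- The operator `βᵀ ⊗ Z` from `ℝˢ ⊗ E` to `E`. -/
def kronRow (β : Fin s → ℝ) (Z : E →ₗ[ℝ] E) : Stages s E →ₗ[ℝ] E where
  toFun U := ∑ i, β i • Z (U i)
  map_add' U V := by simp [Finset.sum_add_distrib]
  map_smul' a U := by simp [Finset.smul_sum, smul_comm a]

/-- The logarithmic 2-norm `μ(J) = max {⟪x, J x⟫ : ‖x‖ = 1}`. -/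
def logNorm (J : E →ₗ[ℝ] E) : ℝ :=
  sSup ((fun x : E => inner ℝ x (J x)) '' Metric.sphere 0 1)

/-- The function `y` is a solution of `y' = J y + g(y)` on the time interval `I`, where `J` has
nonpositive logarithmic norm, `g` is Lipschitz with constant `L` and of class `C^r`, `y` is of class
`C^(r+1)` on `I`, and `M` bounds the derivatives of `g` of the orders `1, …, r` and those of `y` of
the orders `1, …, r+1`. -/
structure IsSemilinearSolution (r : ℕ) (L M : ℝ) (J : E →ₗ[ℝ] E) (g : E → E) (I : Set ℝ)
    (y : ℝ → E) : Prop where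
  hasDeriv : ∀ t ∈ I, HasDerivWithinAt y (J (y t) + g (y t)) I t
  logNorm_nonpos : logNorm J ≤ 0
  lipschitz : ∀ u v : E, ‖g u - g v‖ ≤ L * ‖u - v‖
  contDiff_g : ContDiff ℝ (r : ℕ) g
  contDiffOn_y : ContDiffOn ℝ (r + 1 : ℕ) y I
  bound_y : ∀ t ∈ I, ∀ k ∈ Finset.Icc 1 (r + 1), ‖iteratedDerivWithin k y I t‖ ≤ M
  bound_g : ∀ u : E, ∀ k ∈ Finset.Icc 1 r, ‖iteratedFDeriv ℝ k g u‖ ≤ M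

/-- The stage equations `Y_i = y₀ + h ∑ j, a_ij (J Y_j + g(Y_j))` of a step of size `h`. -/
def IsStageSolution (m : RKMethod s) (J : E →ₗ[ℝ] E) (g : E → E) (h : ℝ) (y₀ : E)
    (Y : Stages s E) : Prop :=
  ∀ i, Y i = y₀ + h • ∑ j, m.A i j • (J (Y j) + g (Y j))

/-- The result `y₀ + h ∑ i, b_i (J Y_i + g(Y_i))` of a step with stages `Y`. -/
def rkStep (m : RKMethod s) (J : E →ₗ[ℝ] E) (g : E → E) (h : ℝ) (y₀ : E) (Y : Stages s E) : E :=
  y₀ + h • ∑ i, m.b i • (J (Y i) + g (Y i))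

/-- The exact solution at the abscissae, `(y(t₀ + c_1 h), …, y(t₀ + c_s h))`. -/
def exactStages (m : RKMethod s) (y : ℝ → E) (t₀ h : ℝ) : Stages s E :=
  WithLp.toLp 2 fun i => y (t₀ + m.c i * h)

/-- The `k`-linear map `d^ℓ/dt^ℓ g^(k)(y(t))`, for `y` given on the time interval `I`. -/
def gDeriv (g : E → E) (I : Set ℝ) (y : ℝ → E) (ℓ k : ℕ) (t : ℝ) : E [×k]→L[ℝ] E :=
  iteratedDerivWithin ℓ (fun τ => iteratedFDeriv ℝ k g (y τ)) I t

/-- The `k`-linear map `d^ℓ/dt^ℓ g^(k)(y(t))` applied stage by stage, to stage vectors. -/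
def gDerivStages (g : E → E) (I : Set ℝ) (y : ℝ → E) (ℓ k : ℕ) (t : ℝ)
    (U : Fin k → Stages s E) : Stages s E :=
  WithLp.toLp 2 fun i => gDeriv g I y ℓ k t fun j => U j i

/-- The inverse `(I - A ⊗ Z)⁻¹` (zero by convention where it does not exist). -/
def resolvent (m : RKMethod s) (Z : E →ₗ[ℝ] E) : Module.End ℝ (Stages s E) :=
  Ring.inverse (1 - kron m.A Z)

open Classical in
/-- The stage elementary differential of a tree. For `τ = [τ₀^ℓ]` it is
`(I - A ⊗ Z)⁻¹ (σ_{ℓ+1} ⊗ y^(ℓ+1)(t))`, where `σ` is the stage residual; for `τ = [τ₀^ℓ τ₁ ⋯ τ_k]`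
with `k ≥ 1` it is `(I - A ⊗ Z)⁻¹ (A C^ℓ ⊗ I) (d^ℓ/dt^ℓ g^(k)(y(t)))` applied to the stage
elementary differentials of `τ₁, …, τ_k`, where `C = diag(c)`. -/
def stagePsi (m : RKMethod s) (g : E → E) (I : Set ℝ) (y : ℝ → E) (Z : E →ₗ[ℝ] E) (t : ℝ)
    (τ : RTree) : Stages s E :=
  if τ.branches = 0 then
    resolvent m Z (kronVec (m.stageResidual (τ.leafCount + 1))
      (iteratedDerivWithin (τ.leafCount + 1) y I t))
  else
    resolvent m Z (kron (m.A * Matrix.diagonal m.c ^ τ.leafCount) LinearMap.id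
      (gDerivStages g I y τ.leafCount τ.branchList.length t fun j =>
        stagePsi m g I y Z t (τ.branchList.get j)))
termination_by τ.order
decreasing_by exact RTree.order_get_branchList_lt τ j

open Classical in
/-- The elementary differential of a tree. For `τ = [τ₀^ℓ]` it is
`q_{ℓ+1} y^(ℓ+1)(t) + (bᵀ ⊗ Z) Ψ_τ`, where `q` is the step residual and `Ψ` the stage elementary
differential; for `τ = [τ₀^ℓ τ₁ ⋯ τ_k]` with `k ≥ 1` it is
`(bᵀ ⊗ I) (I - A ⊗ Z)⁻¹ (C^ℓ ⊗ I) (d^ℓ/dt^ℓ g^(k)(y(t))) (Ψ_{τ₁}, …, Ψ_{τ_k})`. -/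
def psi (m : RKMethod s) (g : E → E) (I : Set ℝ) (y : ℝ → E) (Z : E →ₗ[ℝ] E) (t : ℝ)
    (τ : RTree) : E :=
  if τ.branches = 0 then
    m.stepResidual (τ.leafCount + 1) • iteratedDerivWithin (τ.leafCount + 1) y I t
      + kronRow m.b Z (stagePsi m g I y Z t τ)
  else
    kronRow m.b LinearMap.id (resolvent m Z (kron (Matrix.diagonal m.c ^ τ.leafCount) LinearMap.id
      (gDerivStages g I y τ.leafCount τ.branchList.length t fun j =>
        stagePsi m g I y Z t (τ.branchList.get j))))

end Space

end SemilinearRK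

end

open SemilinearRK

/-! The difficulty is uniformity in the stiffness: no constant may depend on the size of $Z$. In the
error analysis $Z$ occurs only through $(I-A\otimes Z)^{-1}$ and $(b^T\otimes Z)(I-A\otimes
Z)^{-1}$. By Cramer's rule over $\mathbb R[X]$ their entries are rational functions of $Z$ with
denominator $\det(I-zA)$. Stability puts the zeros of this denominator in the open right half-plane,
and boundedness on the negative axis forces the degree of each numerator to be at most that of the
denominator. Such a rational function is bounded on all dissipative operators by a constant that
depends on the function alone (`relBounded_of_natDegree_le`): real linear and quadratic factors are
split off one at a time, each being controlled by pairing with a suitable vector. This gives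
`exists_resolvent_bound`.

The exact solution satisfies the stage equations up to a defect, which is a quadrature error for
$y'$. Since $Jy+g(y)=y'$, its Taylor expansion involves derivatives of $y$ only, and no power of
$J$. Subtraction gives $\delta=(I-A\otimes Z)^{-1}(\mathrm{defect}+h(A\otimes I)\Delta)$ with
$\Delta=g(X)-g(Y)$, where $X$ and $Y$ are the exact and numerical stages. For small $h$ the
Lipschitz term is absorbed, so $\delta=O(h)$.

The expansion is then bootstrapped. If $\delta$ is known up to $O(h^q)$, Taylor expansion of $g$
about $X$ and of $g^{(k)}(y(t))$ about $t_0$ yields $h\Delta$ up to $O(h^{q+1})$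
(`unifO_expansion`), and the error equation improves $\delta$ by one order. Multilinearity produces
a sum over sequences of trees. By the symmetry of higher derivatives a term depends only on the
multiset of its trees, and the number $k!/\prod\mu_i!$ of arrangements is the factor in $\zeta$
(`sum_seq_eq_sum_trees`). The recursion for $\Psi_\tau$ is the error equation read term by term
(`δ_sub_S`); the local error follows through `kronRow_resolvent`.

Uniformity is built into `UnifO`: a single constant serves every element of `StepData`, the type of
all admissible steps in all spaces. -/

noncomputable section

namespace SemilinearRK

universe u v

/-! ### Rational functions of dissipative operators -/

section Dissipative

open Polynomial

variable {E : Type u} [NormedAddCommGroup E] [InnerProductSpace ℝ E]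

/-- An operator is dissipative if its quadratic form is nonpositive. -/
def Dissipative (Z : E →ₗ[ℝ] E) : Prop := ∀ x, inner ℝ x (Z x) ≤ 0

theorem Dissipative.smul {Z : E →ₗ[ℝ] E} (hZ : Dissipative Z) {a : ℝ} (ha : 0 ≤ a) :
    Dissipative (a • Z) := fun x => by
  rw [LinearMap.smul_apply, inner_smul_right]
  exact mul_nonpos_of_nonneg_of_nonpos ha (hZ x)

theorem Dissipative.mul_norm_le {Z : E →ₗ[ℝ] E} (hZ : Dissipative Z) (a : ℝ) (x : E) :
    a * ‖x‖ ≤ ‖Z x - a • x‖ := by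
  rcases (norm_nonneg x).eq_or_lt with h | h
  · rw [← h, mul_zero]; exact norm_nonneg _
  · have h1 := (abs_real_inner_le_norm x (Z x - a • x))
    have h2 : inner ℝ x (Z x - a • x) = inner ℝ x (Z x) - a * (‖x‖ * ‖x‖) := by
      rw [inner_sub_right, inner_smul_right, real_inner_self_eq_norm_mul_norm]
    have h3 := neg_abs_le (inner ℝ x (Z x - a • x))
    have h4 := hZ x
    refine le_of_mul_le_mul_left ?_ h
    nlinarith

/-- The operators `(Z - a)` and `b` are bounded relative to `(Z - a)² + b²`. -/
theorem Dissipative.norm_quadratic {Z : E →ₗ[ℝ] E} (hZ : Dissipative Z) (a b : ℝ) (x : E)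
    {w u : E} (hu : u = Z x - a • x) (hw : w = Z u - a • u + (b ^ 2) • x) :
    a * ‖u‖ ≤ ‖w‖ := by
  rcases (norm_nonneg u).eq_or_lt with h | h
  · rw [← h, mul_zero]; exact norm_nonneg _
  -- Pairing `w` with `u` instead of `x` is what works: $\langle u,w\rangle$ is the sum of $\langle
  -- u,(Z-a)u\rangle\le -a\|u\|^2$ and $b^2\langle x,(Z-a)x\rangle$, which is nonpositive for $a\ge
  -- 0$. For $a<0$ the claim is trivial.
  · have h1 := abs_real_inner_le_norm u w
    have h3 := neg_abs_le (inner ℝ u w)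
    have h4 := hZ u
    have h5 := hZ x
    have h2 : inner ℝ u w = inner ℝ u (Z u) - a * (‖u‖ * ‖u‖) + b ^ 2 * inner ℝ u x := by
      rw [hw, inner_add_right, inner_sub_right, inner_smul_right, inner_smul_right,
        real_inner_self_eq_norm_mul_norm]
    have h6 : inner ℝ u x = inner ℝ x (Z x) - a * (‖x‖ * ‖x‖) := by
      rw [real_inner_comm, hu, inner_sub_right, inner_smul_right,
        real_inner_self_eq_norm_mul_norm]
    refine le_of_mul_le_mul_left ?_ h
    by_cases ha : 0 ≤ a
    · have h7 : inner ℝ u x ≤ 0 := by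
        rw [h6]; nlinarith [mul_nonneg ha (mul_self_nonneg ‖x‖)]
      nlinarith [mul_nonneg (sq_nonneg b) (neg_nonneg.2 h7)]
    · nlinarith [mul_nonneg (norm_nonneg u) (norm_nonneg w), mul_nonneg (norm_nonneg u)
        (norm_nonneg u)]

/-- The estimate `‖p(Z) x‖ ≤ C ‖χ(Z) x‖` holds for all dissipative operators, with a constant which
does not depend on the space or the operator. -/
def RelBounded (p χ : ℝ[X]) : Prop :=
  ∃ C : ℝ, 0 ≤ C ∧ ∀ (E : Type u) [NormedAddCommGroup E] [InnerProductSpace ℝ E]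
    (Z : E →ₗ[ℝ] E), Dissipative Z → ∀ x, ‖aeval Z p x‖ ≤ C * ‖aeval Z χ x‖

theorem RelBounded.add {p q χ : ℝ[X]} (hp : RelBounded.{u} p χ) (hq : RelBounded.{u} q χ) :
    RelBounded.{u} (p + q) χ := by
  obtain ⟨C, hC, h⟩ := hp
  obtain ⟨D, hD, h'⟩ := hq
  refine ⟨C + D, add_nonneg hC hD, fun E _ _ Z hZ x => ?_⟩
  rw [map_add, LinearMap.add_apply, add_mul]
  exact (norm_add_le _ _).trans (add_le_add (h E Z hZ x) (h' E Z hZ x))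

theorem RelBounded.trans {p q χ : ℝ[X]} (hp : RelBounded.{u} p q) (hq : RelBounded.{u} q χ) :
    RelBounded.{u} p χ := by
  obtain ⟨C, hC, h⟩ := hp
  obtain ⟨D, hD, h'⟩ := hq
  refine ⟨C * D, mul_nonneg hC hD, fun E _ _ Z hZ x => ?_⟩
  rw [mul_assoc]
  exact (h E Z hZ x).trans (mul_le_mul_of_nonneg_left (h' E Z hZ x) hC)

theorem RelBounded.mul_right {p χ : ℝ[X]} (hp : RelBounded.{u} p χ) (f : ℝ[X]) :
    RelBounded.{u} (p * f) (χ * f) := by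
  obtain ⟨C, hC, h⟩ := hp
  refine ⟨C, hC, fun E _ _ Z hZ x => ?_⟩
  rw [map_mul, map_mul, Module.End.mul_apply, Module.End.mul_apply]
  exact h E Z hZ _

theorem RelBounded.C_mul {p χ : ℝ[X]} (hp : RelBounded.{u} p χ) (c : ℝ) :
    RelBounded.{u} (C c * p) χ := by
  obtain ⟨D, hD, h⟩ := hp
  refine ⟨|c| * D, mul_nonneg (abs_nonneg _) hD, fun E _ _ Z hZ x => ?_⟩
  rw [map_mul, aeval_C, Module.algebraMap_end_eq_smul_id, Module.End.mul_apply,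
    LinearMap.smul_apply, LinearMap.id_apply, norm_smul, Real.norm_eq_abs, mul_assoc]
  exact mul_le_mul_of_nonneg_left (h E Z hZ x) (abs_nonneg _)

theorem relBounded_one_linear {a : ℝ} (ha : 0 < a) : RelBounded.{u} 1 (X - C a) := by
  refine ⟨a⁻¹, by positivity, fun E _ _ Z hZ x => ?_⟩
  have := hZ.mul_norm_le a x
  rw [inv_mul_eq_div, le_div_iff₀' ha]
  simpa using this

/-- The quadratic is $(X-a)^2+b^2$ with $z=a+ib$. It dominates $X-a$, which dominates $1$, and
$X=(X-a)+a\cdot 1$. -/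
theorem relBounded_quadratic {z : ℂ} (ha : 0 < z.re) :
    RelBounded.{u} 1 (X ^ 2 - C (2 * z.re) * X + C (‖z‖ ^ 2)) ∧
      RelBounded.{u} X (X ^ 2 - C (2 * z.re) * X + C (‖z‖ ^ 2)) := by
  have hn : ‖z‖ ^ 2 = z.re ^ 2 + z.im ^ 2 := by
    rw [← Complex.normSq_eq_norm_sq, Complex.normSq_apply]; ring
  have key : RelBounded.{u} (X - C z.re) (X ^ 2 - C (2 * z.re) * X + C (‖z‖ ^ 2)) := by
    refine ⟨z.re⁻¹, by positivity, fun E _ _ Z hZ x => ?_⟩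
    rw [inv_mul_eq_div, le_div_iff₀' ha]
    refine hZ.norm_quadratic z.re z.im x ?_ ?_
    · simp
    · rw [hn]
      simp [pow_two, two_mul]
      module
  have h1 := (relBounded_one_linear ha).trans key
  refine ⟨h1, ?_⟩
  have := key.add (h1.C_mul z.re)
  rwa [mul_one, sub_add_cancel] at this

/-- A stable polynomial has a monic factor of positive degree that dominates all polynomials of
smaller degree. -/
theorem exists_dominating_factor {χ : ℝ[X]} (hχ : ∀ z : ℂ, aeval z χ = 0 → 0 < z.re)
    (hdeg : χ.natDegree ≠ 0) :
    ∃ f : ℝ[X], f.Monic ∧ f.natDegree ≠ 0 ∧ f ∣ χ ∧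
      ∀ p : ℝ[X], p.degree < f.degree → RelBounded.{u} p f := by
  obtain ⟨z, hz⟩ : ∃ z : ℂ, aeval z χ = 0 := IsAlgClosed.exists_aeval_eq_zero _ χ
    (fun h => hdeg (natDegree_eq_zero_iff_degree_le_zero.2 h.le))
  have ha := hχ z hz
  by_cases him : z.im = 0
  · have hz' : z = (z.re : ℂ) := Complex.ext rfl (by simpa using him)
    refine ⟨X - C z.re, monic_X_sub_C _, by simp, ?_, fun p hp => ?_⟩
    · rw [dvd_iff_isRoot, IsRoot.def]
      rw [hz', ← Complex.coe_algebraMap, aeval_algebraMap_apply] at hz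
      simpa using hz
    · rw [degree_X_sub_C] at hp
      rw [eq_C_of_degree_le_zero (Nat.WithBot.lt_one_iff_le_zero.1 hp)]
      simpa using (relBounded_one_linear ha).C_mul (p.coeff 0)
  · have hq : (X ^ 2 - C (2 * z.re) * X + C (‖z‖ ^ 2) : ℝ[X]).degree = 2 := by
      compute_degree!
    have hm : (X ^ 2 - C (2 * z.re) * X + C (‖z‖ ^ 2) : ℝ[X]).Monic := by monicity!
    refine ⟨_, hm, ?_, quadratic_dvd_of_aeval_eq_zero_im_ne_zero χ hz him, fun p hp => ?_⟩
    · rw [natDegree_eq_of_degree_eq_some hq]; norm_num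
    · rw [hq] at hp
      have : p = C (p.coeff 1) * X + C (p.coeff 0) * 1 := by
        rw [mul_one]
        refine eq_X_add_C_of_degree_le_one ((degree_le_iff_coeff_zero _ _).2 fun n hn => ?_)
        exact coeff_eq_zero_of_degree_lt (hp.trans_le (by
          have : 1 < n := by exact_mod_cast hn
          exact_mod_cast this))
      rw [this]
      exact ((relBounded_quadratic ha).2.C_mul _).add ((relBounded_quadratic ha).1.C_mul _)

/-- Write $\chi=f\chi'$ with a dominating factor $f$ and divide: $p=(p \bmod f)+f\,(p/f)$. The
remainder is dominated by $f$, and $f=1\cdot f$ by $\chi' f$; the quotient is dominated by $\chi'$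
by induction on the degree. This is a qualitative von Neumann inequality, free of spectral theory
and of the dimension. -/
theorem relBounded_of_natDegree_le {χ p : ℝ[X]} (hχ : ∀ z : ℂ, aeval z χ = 0 → 0 < z.re)
    (hp : p.natDegree ≤ χ.natDegree) : RelBounded.{u} p χ := by
  induction hn : χ.natDegree using Nat.strong_induction_on generalizing χ p with
  | _ n ih =>
    have hχ0 : χ ≠ 0 := by
      rintro rfl
      simpa using hχ 0 (by simp)
    by_cases hdeg : χ.natDegree = 0
    · rw [hdeg, Nat.le_zero] at hp
      rw [eq_C_of_natDegree_eq_zero hp]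
      rw [eq_C_of_natDegree_eq_zero hdeg] at hχ0 ⊢
      have h0 : χ.coeff 0 ≠ 0 := fun h => hχ0 (by rw [h, C_0])
      refine ⟨|p.coeff 0 / χ.coeff 0|, abs_nonneg _, fun E _ _ Z hZ x => le_of_eq ?_⟩
      have h0' : |χ.coeff 0| ≠ 0 := abs_ne_zero.2 h0
      simp only [aeval_C, Module.algebraMap_end_eq_smul_id, LinearMap.smul_apply,
        LinearMap.id_apply, norm_smul, Real.norm_eq_abs, abs_div]
      field_simp
    · obtain ⟨f, hf, hf0, ⟨χ', rfl⟩, hb⟩ := exists_dominating_factor.{u} hχ hdeg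
      have hχ'0 : χ' ≠ 0 := right_ne_zero_of_mul hχ0
      have hd : (f * χ').natDegree = f.natDegree + χ'.natDegree :=
        natDegree_mul hf.ne_zero hχ'0
      have hstab : ∀ z : ℂ, aeval z χ' = 0 → 0 < z.re := fun z hz => hχ z (by simp [hz])
      have h1 : RelBounded.{u} (p /ₘ f) χ' := by
        refine ih χ'.natDegree (by omega) hstab ?_ rfl
        rw [natDegree_divByMonic p hf]; omega
      have h2 : RelBounded.{u} 1 χ' := ih χ'.natDegree (by omega) hstab (by simp) rfl
      have h3 : RelBounded.{u} (p %ₘ f) f := hb _ (degree_modByMonic_lt p hf)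
      have h4 := (h2.mul_right f)
      rw [one_mul] at h4
      have h5 := (h3.trans h4).add (h1.mul_right f)
      rwa [mul_comm (p /ₘ f), modByMonic_add_div, mul_comm] at h5

end Dissipative

/-! ### The resolvent of a stable method -/

section StageNorm

variable {s : ℕ} {E : Type u} [NormedAddCommGroup E]

theorem norm_stage_le (U : Stages s E) (i : Fin s) : ‖U i‖ ≤ ‖U‖ := PiLp.norm_apply_le U i

theorem norm_le_sum_stages (U : Stages s E) : ‖U‖ ≤ ∑ i, ‖U i‖ := by
  rw [PiLp.norm_eq_of_L2]
  refine Real.sqrt_le_iff.2 ⟨Finset.sum_nonneg fun i _ => norm_nonneg _, ?_⟩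
  exact Finset.sum_sq_le_sq_sum_of_nonneg fun i _ => norm_nonneg _

end StageNorm

section Pencil

open Polynomial

variable {s : ℕ}

/-- A matrix of polynomials, evaluated at an operator. -/
def kronPoly {E : Type u} [NormedAddCommGroup E] [InnerProductSpace ℝ E]
    (P : Matrix (Fin s) (Fin s) ℝ[X]) (Z : E →ₗ[ℝ] E) : Module.End ℝ (Stages s E) where
  toFun U := WithLp.toLp 2 fun i => ∑ j, aeval Z (P i j) (U j)
  map_add' U V := by ext i; simp [Finset.sum_add_distrib]
  map_smul' a U := by ext i; simp [Finset.smul_sum]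

theorem kronPoly_apply {E : Type u} [NormedAddCommGroup E] [InnerProductSpace ℝ E]
    (P : Matrix (Fin s) (Fin s) ℝ[X]) (Z : E →ₗ[ℝ] E) (U : Stages s E) (i : Fin s) :
    kronPoly P Z U i = ∑ j, aeval Z (P i j) (U j) := rfl

/-- Evaluation at $Z$ is multiplicative, so the adjugate identity for the pencil carries over to
operators on the stage space. -/
theorem kronPoly_mul {E : Type u} [NormedAddCommGroup E] [InnerProductSpace ℝ E]
    (P Q : Matrix (Fin s) (Fin s) ℝ[X]) (Z : E →ₗ[ℝ] E) :
    kronPoly (P * Q) Z = kronPoly P Z * kronPoly Q Z := by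
  ext U i
  simp only [Module.End.mul_apply, kronPoly_apply, Matrix.mul_apply, map_sum, map_mul,
    LinearMap.sum_apply]
  rw [Finset.sum_comm]

theorem kronPoly_smul_one {E : Type u} [NormedAddCommGroup E] [InnerProductSpace ℝ E]
    (χ : ℝ[X]) (Z : E →ₗ[ℝ] E) (U : Stages s E) (i : Fin s) :
    kronPoly (χ • (1 : Matrix (Fin s) (Fin s) ℝ[X])) Z U i = aeval Z χ (U i) := by
  rw [kronPoly_apply, Finset.sum_eq_single i]
  · simp
  · intro j _ hj; simp [Matrix.one_apply_ne hj.symm]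
  · simp

variable (m : RKMethod s)

namespace RKMethod

/-- The matrix pencil `I - X A`. -/
def pencil : Matrix (Fin s) (Fin s) ℝ[X] := 1 - (X : ℝ[X]) • m.A.map C

theorem kronPoly_pencil {E : Type u} [NormedAddCommGroup E] [InnerProductSpace ℝ E]
    (Z : E →ₗ[ℝ] E) : kronPoly m.pencil Z = 1 - kron m.A Z := by
  ext U i
  have h : ∀ j, aeval Z (m.pencil i j) (U j)
      = (if i = j then U j else 0) - m.A i j • Z (U j) := fun j => by
    by_cases hij : i = j <;>
      simp [pencil, hij, Module.algebraMap_end_apply]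
  simp [kronPoly_apply, h, Finset.sum_sub_distrib, kron]

theorem map_pencil (z : ℂ) : m.pencil.map (aeval z) = m.oneSub z := by
  ext i j
  by_cases hij : i = j <;> simp [pencil, oneSub, hij] <;> exact mul_comm _ _

theorem aeval_det_pencil (z : ℂ) : aeval z m.pencil.det = (m.oneSub z).det := by
  rw [← map_pencil, AlgHom.map_det]; rfl

theorem inv_oneSub_apply (z : ℂ) (i j : Fin s) :
    (m.oneSub z)⁻¹ i j = (aeval z m.pencil.det)⁻¹ * aeval z (m.pencil.adjugate i j) := by
  have h : (m.oneSub z).adjugate i j = aeval z (m.pencil.adjugate i j) := by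
    rw [← map_pencil]
    have := AlgHom.map_adjugate (aeval z : ℝ[X] →ₐ[ℝ] ℂ) m.pencil
    exact (congrFun (congrFun this i) j).symm
  rw [Matrix.inv_def, Ring.inverse_eq_inv', ← aeval_det_pencil, Matrix.smul_apply, h, smul_eq_mul]

variable {m}

theorem IsASIStable.re_pos_of_root (h : m.IsASIStable) {z : ℂ}
    (hz : aeval z m.pencil.det = 0) : 0 < z.re := by
  by_contra hre
  have := (Matrix.isUnit_iff_isUnit_det _).1 (h.1 z (not_lt.1 hre))
  rw [← aeval_det_pencil, hz] at this
  exact not_isUnit_zero this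

/-- A rational function with numerator of larger degree is unbounded near $-\infty$. Only the
negative real axis of the stability half-plane is needed to compare degrees. -/
theorem natDegree_le_of_bounded {p χ : ℝ[X]} (hχ : χ ≠ 0) {K : ℝ}
    (h : ∀ x : ℝ, x ≤ 0 → |p.eval x / χ.eval x| ≤ K) : p.natDegree ≤ χ.natDegree := by
  by_contra hlt
  have ht := abs_div_tendsto_atBot_atTop_of_degree_gt p χ
    (degree_lt_degree (not_le.1 hlt)) hχ
  obtain ⟨x, hx, hx'⟩ := ((ht.eventually_gt_atTop K).and (Filter.eventually_le_atBot 0)).exists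
  exact absurd (h x hx') (not_le.2 hx)

theorem IsASIStable.natDegree_adjugate_le (h : m.IsASIStable) (i j : Fin s) :
    (m.pencil.adjugate i j).natDegree ≤ m.pencil.det.natDegree := by
  have h0 : m.pencil.det ≠ 0 := fun h0 => by simpa using h.re_pos_of_root (z := 0) (by simp [h0])
  obtain ⟨K, hK⟩ := h.2
  refine natDegree_le_of_bounded h0 (K := K) fun x hx => ?_
  have := hK x (by simpa using hx) i j
  rw [inv_oneSub_apply, ← Complex.coe_algebraMap, aeval_algebraMap_apply,
    aeval_algebraMap_apply] at this
  simpa [div_eq_inv_mul, abs_mul] using this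

/-- The polynomial on the left is the numerator of the $j$-th entry of $z\,b^T(I-zA)^{-1}$; its
factor $X$ is where AS-stability gives more than ASI-stability. -/
theorem IsASStable.natDegree_le (h : m.IsASStable) (h' : m.IsASIStable) (j : Fin s) :
    (X * ∑ i, C (m.b i) * m.pencil.adjugate i j).natDegree ≤ m.pencil.det.natDegree := by
  have h0 : m.pencil.det ≠ 0 := fun h0 => by simpa using h'.re_pos_of_root (z := 0) (by simp [h0])
  obtain ⟨K, hK⟩ := h.2
  refine natDegree_le_of_bounded h0 (K := K) fun x hx => ?_
  have h1 := hK x (by simpa using hx) j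
  have h2 : (x : ℂ) * Matrix.vecMul (fun i => (m.b i : ℂ)) (m.oneSub x)⁻¹ j
      = (((X * ∑ i, C (m.b i) * m.pencil.adjugate i j).eval x / m.pencil.det.eval x : ℝ) : ℂ) := by
    simp only [Matrix.vecMul, dotProduct, inv_oneSub_apply]
    simp only [← Complex.coe_algebraMap, aeval_algebraMap_apply]
    simp only [Complex.coe_algebraMap, coe_aeval_eq_eval, eval_mul, eval_X, eval_finsetSum, eval_C]
    push_cast
    rw [mul_div_assoc, Finset.sum_div]
    congr 1
    exact Finset.sum_congr rfl fun i _ => by rw [div_eq_mul_inv]; ring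
  rw [h2, Complex.norm_real, Real.norm_eq_abs] at h1
  exact h1

/-- The operators `(I - A ⊗ Z)⁻¹` and `(bᵀ ⊗ Z) (I - A ⊗ Z)⁻¹` of a stable method are uniformly
bounded for dissipative `Z`. -/
theorem exists_resolvent_bound (hAS : m.IsASStable) (hASI : m.IsASIStable) :
    ∃ K : ℝ, 0 ≤ K ∧ ∀ (E : Type u) [NormedAddCommGroup E] [InnerProductSpace ℝ E]
      [FiniteDimensional ℝ E] (Z : E →ₗ[ℝ] E), Dissipative Z →
      IsUnit (1 - kron m.A Z) ∧ ∀ U, ‖resolvent m Z U‖ ≤ K * ‖U‖ ∧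
        ‖kronRow m.b Z (resolvent m Z U)‖ ≤ K * ‖U‖ := by
  set χ := m.pencil.det with hχdef
  have hχ : ∀ z : ℂ, aeval z χ = 0 → 0 < z.re := fun z hz => hASI.re_pos_of_root hz
  choose B hB0 hB using fun i j => relBounded_of_natDegree_le.{u} hχ
    (hASI.natDegree_adjugate_le i j)
  choose B' hB'0 hB' using fun j => relBounded_of_natDegree_le.{u} hχ (hAS.natDegree_le hASI j)
  obtain ⟨B₁, -, hB₁⟩ := relBounded_of_natDegree_le.{u} (p := 1) hχ (by simp)
  have hS : 0 ≤ ∑ i, ∑ j, B i j := Finset.sum_nonneg fun i _ => Finset.sum_nonneg fun j _ => hB0 i j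
  have hS' : 0 ≤ ∑ j, B' j := Finset.sum_nonneg fun j _ => hB'0 j
  refine ⟨∑ i, ∑ j, B i j + ∑ j, B' j, add_nonneg hS hS', fun E _ _ _ Z hZ => ?_⟩
  -- The constant polynomial $1$ is dominated by $\chi$, which bounds $\chi(Z)$ from below. Finite
  -- dimension then makes $\chi(Z)$ invertible.
  have hinj : Function.Injective (aeval Z χ) := by
    refine (injective_iff_map_eq_zero _).2 fun x hx => ?_
    have := hB₁ E Z hZ x
    rw [hx, norm_zero, mul_zero, map_one] at this
    simpa using this
  have hsurj := LinearMap.injective_iff_surjective.1 hinj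
  have hQ : (1 - kron m.A Z) * kronPoly m.pencil.adjugate Z = kronPoly (χ • 1) Z := by
    rw [← kronPoly_pencil, ← kronPoly_mul, Matrix.mul_adjugate]
  have hQ' : kronPoly m.pencil.adjugate Z * (1 - kron m.A Z) = kronPoly (χ • 1) Z := by
    rw [← kronPoly_pencil, ← kronPoly_mul, Matrix.adjugate_mul]
  have hD : Function.Injective (kronPoly (s := s) (χ • 1) Z) := fun U V h => by
    ext i
    apply hinj
    rw [← kronPoly_smul_one, ← kronPoly_smul_one, h]
  have hunit : IsUnit (1 - kron m.A Z) := by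
    rw [Module.End.isUnit_iff]
    have : Function.Injective (1 - kron m.A Z : Module.End ℝ (Stages s E)) := by
      rw [← hQ', Module.End.mul_eq_comp, LinearMap.coe_comp] at hD
      exact hD.of_comp
    exact ⟨this, LinearMap.injective_iff_surjective.1 this⟩
  refine ⟨hunit, fun U => ?_⟩
  -- With $\chi(Z)u_i=U_i$ the resolvent of $U$ is $\mathrm{adj}(Z)u$, so bounding it means
  -- comparing $p(Z)u_j$ with $\chi(Z)u_j=U_j$ for polynomials $p$ of admissible degree.
  choose u hu using fun i => hsurj (U i)
  have hU : U = (1 - kron m.A Z) (kronPoly m.pencil.adjugate Z (WithLp.toLp 2 u)) := by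
    rw [← Module.End.mul_apply, hQ]
    ext i
    rw [kronPoly_smul_one]
    exact (hu i).symm
  have hV : resolvent m Z U = kronPoly m.pencil.adjugate Z (WithLp.toLp 2 u) := by
    conv_lhs => rw [hU]
    rw [resolvent, ← Module.End.mul_apply, Ring.inverse_mul_cancel _ hunit, Module.End.one_apply]
  have hU0 := norm_nonneg U
  rw [hV]
  constructor
  · refine (norm_le_sum_stages _).trans ?_
    have : ∀ i, ‖kronPoly m.pencil.adjugate Z (WithLp.toLp 2 u) i‖ ≤ (∑ j, B i j) * ‖U‖ :=
      fun i => by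
        rw [kronPoly_apply, Finset.sum_mul]
        refine norm_sum_le_of_le _ fun j _ => ?_
        refine (hB i j E Z hZ _).trans (mul_le_mul_of_nonneg_left ?_ (hB0 i j))
        exact (congrArg norm (hu j)).trans_le (norm_stage_le U j)
    refine (Finset.sum_le_sum fun i _ => this i).trans ?_
    rw [← Finset.sum_mul]
    exact mul_le_mul_of_nonneg_right (le_add_of_nonneg_right hS') hU0
  · have : kronRow m.b Z (kronPoly m.pencil.adjugate Z (WithLp.toLp 2 u))
        = ∑ j, aeval Z (X * ∑ i, C (m.b i) * m.pencil.adjugate i j) (u j) := by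
      simp only [kronRow, LinearMap.coe_mk, AddHom.coe_mk, kronPoly_apply, map_mul, map_sum,
        aeval_X, aeval_C, Module.End.mul_apply, LinearMap.sum_apply, Module.algebraMap_end_apply,
        Finset.smul_sum, map_smul]
      rw [Finset.sum_comm]
    rw [this]
    refine (norm_sum_le_of_le (n := fun j => B' j * ‖U‖) _ fun j _ => ?_).trans ?_
    · refine (hB' j E Z hZ _).trans (mul_le_mul_of_nonneg_left ?_ (hB'0 j))
      exact (congrArg norm (hu j)).trans_le (norm_stage_le U j)
    · rw [← Finset.sum_mul]
      exact mul_le_mul_of_nonneg_right (le_add_of_nonneg_left hS) hU0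

end RKMethod

end Pencil

/-! ### Taylor expansions and higher derivatives -/

section Taylor

variable {F : Type v} [NormedAddCommGroup F] [NormedSpace ℝ F]

/-- The derivative of the remainder is the remainder of the shifted chain $f_1,f_2,\dots$, so the
mean value inequality raises the order by one; the factor $1/n!$ is given up. A chain of one-sided
derivatives on a convex set covers endpoints and points to the left of $x_0$, as occur for negative
abscissae. -/
theorem taylor_remainder_le {S : Set ℝ} (hS : Convex ℝ S) {x₀ : ℝ} (hx₀ : x₀ ∈ S) {C : ℝ}
    {n : ℕ} {f : ℕ → ℝ → F}
    (hf : ∀ k < n, ∀ t ∈ S, HasDerivWithinAt (f k) (f (k + 1) t) S t)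
    (hC : ∀ t ∈ S, ‖f n t‖ ≤ C) {x : ℝ} (hx : x ∈ S) :
    ‖f 0 x - ∑ k ∈ Finset.range n, ((x - x₀) ^ k / (k ! : ℝ)) • f k x₀‖ ≤ C * |x - x₀| ^ n := by
  induction n generalizing f x with
  | zero => simpa using hC x hx
  | succ n ih =>
    have hC0 : 0 ≤ C := (norm_nonneg _).trans (hC x hx)
    have hsub : Set.uIcc x₀ x ⊆ S := by
      rw [← segment_eq_uIcc]; exact hS.segment_subset hx₀ hx
    set R : ℝ → F := fun t =>
      f 0 t - ∑ k ∈ Finset.range (n + 1), ((t - x₀) ^ k / (k ! : ℝ)) • f k x₀ with hR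
    have hd : ∀ t ∈ Set.uIcc x₀ x, HasDerivWithinAt R
        (f 1 t - ∑ k ∈ Finset.range n, ((t - x₀) ^ k / (k ! : ℝ)) • f (k + 1) x₀)
        (Set.uIcc x₀ x) t := by
      intro t ht
      refine ((hf 0 n.succ_pos t (hsub ht)).mono hsub).sub ?_
      simp only [Finset.sum_range_succ' _ n]
      rw [← add_zero (∑ k ∈ Finset.range n, _)]
      refine HasDerivWithinAt.add ?_ ?_
      · refine HasDerivWithinAt.fun_sum fun k _ => ?_
        have h1 : HasDerivAt (fun t : ℝ => (t - x₀) ^ (k + 1) / ((k + 1)! : ℝ))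
            ((t - x₀) ^ k / (k ! : ℝ)) t := by
          have := (((hasDerivAt_id t).sub_const x₀).pow (k + 1)).div_const ((k + 1)! : ℝ)
          refine this.congr_deriv ?_
          have hk : (k ! : ℝ) ≠ 0 := by positivity
          rw [Nat.factorial_succ]
          push_cast
          have hk' : (k : ℝ) + 1 ≠ 0 := by positivity
          simp only [id]
          field_simp
        exact (h1.smul_const _).hasDerivWithinAt
      · simpa using hasDerivWithinAt_const t (Set.uIcc x₀ x) (f 0 x₀)
    have hb : ∀ t ∈ Set.uIcc x₀ x,
        ‖f 1 t - ∑ k ∈ Finset.range n, ((t - x₀) ^ k / (k ! : ℝ)) • f (k + 1) x₀‖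
          ≤ C * |x - x₀| ^ n := by
      intro t ht
      refine (ih (f := fun k => f (k + 1)) (fun k hk t ht => hf (k + 1) (by omega) t ht) hC
        (hsub ht)).trans ?_
      have : |t - x₀| ≤ |x - x₀| := by
        rw [abs_sub_comm t, abs_sub_comm x]
        rw [Set.uIcc_comm] at ht
        exact Set.abs_sub_right_of_mem_uIcc ht
      gcongr
    have := (convex_uIcc x₀ x).norm_image_sub_le_of_norm_hasDerivWithin_le hd hb
      Set.left_mem_uIcc Set.right_mem_uIcc
    have hR0 : R x₀ = 0 := by
      simp [hR, Finset.sum_range_succ' _ n]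
    rw [hR0, sub_zero] at this
    rw [pow_succ, ← mul_assoc]
    exact this

theorem hasDerivWithinAt_iteratedDerivWithin {S : Set ℝ} (hS : UniqueDiffOn ℝ S) {f : ℝ → F}
    {n k : ℕ} (hf : ContDiffOn ℝ n f S) (hk : k < n) {t : ℝ} (ht : t ∈ S) :
    HasDerivWithinAt (iteratedDerivWithin k f S) (iteratedDerivWithin (k + 1) f S t) S t := by
  rw [iteratedDerivWithin_succ]
  exact (hf.differentiableOn_iteratedDerivWithin (by exact_mod_cast hk) hS t ht).hasDerivWithinAt

variable {E : Type u} [NormedAddCommGroup E] [NormedSpace ℝ E]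

/-- The one-variable estimate is applied to $\theta\mapsto g(u+\theta v)$ between $0$ and $1$. -/
theorem taylor_line_remainder_le {g : E → F} {r n : ℕ} (hg : ContDiff ℝ r g) (hn : n ≤ r) {M : ℝ}
    (hM : ∀ x, ‖iteratedFDeriv ℝ n g x‖ ≤ M) (u v : E) :
    ‖g (u + v) - ∑ k ∈ Finset.range n, (1 / (k ! : ℝ)) • iteratedFDeriv ℝ k g u (fun _ => v)‖
      ≤ M * ‖v‖ ^ n := by
  have key := taylor_remainder_le (S := Set.univ) convex_univ (Set.mem_univ (0 : ℝ))
    (C := M * ‖v‖ ^ n) (n := n)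
    (f := fun k θ => iteratedFDeriv ℝ k g (u + θ • v) (fun _ => v)) ?_ ?_ (Set.mem_univ 1)
  · simpa using key
  · intro k hk θ _
    have h1 : HasDerivAt (fun θ : ℝ => u + θ • v) v θ := by
      simpa using ((hasDerivAt_id θ).smul_const v).const_add u
    have h2 := (hg.differentiable_iteratedFDeriv (m := k)
      (by exact_mod_cast hk.trans_le hn) (u + θ • v)).hasFDerivAt
    have h3 := (ContinuousMultilinearMap.apply ℝ (fun _ : Fin k => E) F
      (fun _ => v)).hasFDerivAt.comp_hasDerivAt θ (h2.comp_hasDerivAt θ h1)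
    refine HasDerivAt.hasDerivWithinAt (h3.congr_deriv ?_)
    rw [iteratedFDeriv_succ_apply_left]
    rfl
  · intro θ _
    refine (ContinuousMultilinearMap.le_opNorm _ _).trans ?_
    simpa using mul_le_mul_of_nonneg_right (hM _) (pow_nonneg (norm_nonneg v) n)

/-- The expression is $g^{(i+k)}$ with $k$ slots filled by $w$. The slots are filled one by one from
the right: $g$ is replaced by $x\mapsto g'(x)w_{\mathrm{last}}$, whose derivatives are bounded by
$B\|w_{\mathrm{last}}\|$ and need one order less. -/
theorem norm_iteratedFDeriv_iteratedFDeriv_apply_le {g : E → F} {i k : ℕ}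
    (hg : ContDiff ℝ (i + k : ℕ) g) {B : ℝ} (hB : ∀ x, ‖iteratedFDeriv ℝ (i + k) g x‖ ≤ B)
    (x : E) (w : Fin k → E) :
    ‖iteratedFDeriv ℝ i (fun x => iteratedFDeriv ℝ k g x w) x‖ ≤ B * ∏ j, ‖w j‖ := by
  induction k generalizing g B with
  | zero => simpa using hB x
  | succ k ih =>
    have hfd : ContDiff ℝ (i + k : ℕ) (fderiv ℝ g) := hg.fderiv_right (by norm_cast)
    set T := ContinuousLinearMap.apply ℝ F (w (Fin.last k)) with hT
    have h1 : ∀ j ≤ i + k, ∀ x, iteratedFDeriv ℝ j (T ∘ fderiv ℝ g) x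
        = T.compContinuousMultilinearMap (iteratedFDeriv ℝ j (fderiv ℝ g) x) := fun j hj x =>
      T.iteratedFDeriv_comp_left hfd.contDiffAt (by exact_mod_cast hj)
    have h2 : (fun x => iteratedFDeriv ℝ (k + 1) g x w)
        = fun x => iteratedFDeriv ℝ k (T ∘ fderiv ℝ g) x (Fin.init w) := by
      funext x
      rw [h1 k (by omega), iteratedFDeriv_succ_apply_right]
      rfl
    rw [h2, Fin.prod_univ_castSucc, mul_comm (∏ j, _), ← mul_assoc]
    refine ih (g := T ∘ fderiv ℝ g) (T.contDiff.comp hfd) (fun x => ?_) (Fin.init w)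
    rw [h1 _ le_rfl]
    refine ContinuousMultilinearMap.opNorm_le_bound
      (mul_nonneg ((norm_nonneg _).trans (hB x)) (norm_nonneg _)) fun z => ?_
    refine ((iteratedFDeriv ℝ (i + k) (fderiv ℝ g) x z).le_opNorm (w (Fin.last k))).trans ?_
    rw [mul_right_comm]
    refine mul_le_mul_of_nonneg_right ?_ (norm_nonneg _)
    refine ((iteratedFDeriv ℝ (i + k) (fderiv ℝ g) x).le_opNorm z).trans ?_
    refine mul_le_mul_of_nonneg_right ?_ (Finset.prod_nonneg fun j _ => norm_nonneg _)
    rw [norm_iteratedFDeriv_fderiv]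
    exact hB x

theorem fderiv_iteratedFDeriv_apply {g : E → F} {n : ℕ} (hg : ContDiff ℝ (n + 1 : ℕ) g) (x a : E)
    (w : Fin n → E) :
    fderiv ℝ (iteratedFDeriv ℝ n g) x a w = fderiv ℝ (fun y => iteratedFDeriv ℝ n g y w) x a := by
  have h2 := (hg.differentiable_iteratedFDeriv (m := n)
    (by exact_mod_cast n.lt_succ_self) x).hasFDerivAt
  have h3 := (ContinuousMultilinearMap.apply ℝ (fun _ : Fin n => E) F w).hasFDerivAt.comp x h2
  exact (congrArg (fun T : E →L[ℝ] F => T a) h3.fderiv).symm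

/-- Exchanging the first two slots is the symmetry of the second derivative of $g^{(n-1)}$. Any
other adjacent exchange leaves the first slot alone and is inherited by differentiating the identity
of one order less. -/
theorem iteratedFDeriv_comp_adjacent_swap {g : E → F} {n : ℕ} (hg : ContDiff ℝ (n + 1 : ℕ) g)
    (i : Fin n) (x : E) (w : Fin (n + 1) → E) :
    iteratedFDeriv ℝ (n + 1) g x (w ∘ Equiv.swap i.castSucc i.succ)
      = iteratedFDeriv ℝ (n + 1) g x w := by
  induction n generalizing x with
  | zero => exact i.elim0
  | succ n ih =>
    have hg' : ContDiff ℝ (n + 1 : ℕ) g := hg.of_le (by exact_mod_cast Nat.le_succ _)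
    rw [iteratedFDeriv_succ_apply_left, iteratedFDeriv_succ_apply_left]
    refine Fin.cases ?_ (fun j => ?_) i
    · have hcd : ContDiff ℝ 2 (iteratedFDeriv ℝ n g) := hg.iteratedFDeriv_right (by
        push_cast; rw [add_comm, add_assoc]; norm_num)
      have hsnd : ∀ (a : E) (w : Fin (n + 1) → E),
          fderiv ℝ (iteratedFDeriv ℝ (n + 1) g) x a w
            = fderiv ℝ (fderiv ℝ (iteratedFDeriv ℝ n g)) x a (w 0) (Fin.tail w) := by
        intro a w
        rw [fderiv_iteratedFDeriv_apply hg]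
        simp only [iteratedFDeriv_succ_apply_left]
        have hd : DifferentiableAt ℝ (fderiv ℝ (iteratedFDeriv ℝ n g)) x :=
          (hcd.fderiv_right (m := 1) (by norm_num)).differentiable (by norm_num) x
        have h3 := (ContinuousMultilinearMap.apply ℝ (fun _ : Fin n => E) F
          (Fin.tail w)).hasFDerivAt.comp x (hd.hasFDerivAt.clm_apply (hasFDerivAt_const (w 0) x))
        refine (congrArg (fun T : E →L[ℝ] F => T a) h3.fderiv).trans ?_
        simp
      have hsymm : IsSymmSndFDerivAt ℝ (iteratedFDeriv ℝ n g) x :=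
        hcd.contDiffAt.isSymmSndFDerivAt (by simp)
      rw [hsnd, hsnd, hsymm.eq]
      have h0 : (w ∘ Equiv.swap (Fin.castSucc 0) (Fin.succ (0 : Fin (n + 1)))) 0
          = Fin.tail w 0 := by
        simp [Fin.tail]
      have h1 : Fin.tail (w ∘ Equiv.swap (Fin.castSucc 0) (Fin.succ (0 : Fin (n + 1)))) 0
          = w 0 := by
        simp [Fin.tail]
      have h2 : Fin.tail (Fin.tail (w ∘ Equiv.swap (Fin.castSucc 0) (Fin.succ (0 : Fin (n + 1)))))
          = Fin.tail (Fin.tail w) := by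
        ext k
        simp only [Fin.tail, Function.comp_apply]
        rw [Equiv.swap_apply_of_ne_of_ne]
        · simp [Fin.ext_iff]
        · simp [Fin.ext_iff]
      rw [h0, h1, h2]
    · have h0 : (w ∘ Equiv.swap j.succ.castSucc j.succ.succ) 0 = w 0 := by
        simp only [Function.comp_apply]
        rw [Equiv.swap_apply_of_ne_of_ne] <;> simp [Fin.ext_iff]
      have h1 : Fin.tail (w ∘ Equiv.swap j.succ.castSucc j.succ.succ)
          = Fin.tail w ∘ Equiv.swap j.castSucc j.succ := by
        ext k
        simp only [Fin.tail, Function.comp_apply]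
        rw [← Fin.succ_castSucc, (Fin.succ_injective _).swap_apply]
      rw [h0, h1, fderiv_iteratedFDeriv_apply hg, fderiv_iteratedFDeriv_apply hg]
      simp only [ih hg' j]

/-- Adjacent transpositions generate the symmetric group. This symmetry is what allows unordered
trees to index the expansion. -/
theorem iteratedFDeriv_comp_perm {g : E → F} {n : ℕ} (hg : ContDiff ℝ n g)
    (x : E) (w : Fin n → E) (σ : Equiv.Perm (Fin n)) :
    iteratedFDeriv ℝ n g x (w ∘ σ) = iteratedFDeriv ℝ n g x w := by
  cases n with
  | zero => congr 1; ext i; exact i.elim0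
  | succ n =>
    have hσ : σ ∈ Submonoid.closure
        (Set.range fun i : Fin n => Equiv.swap i.castSucc i.succ) := by
      rw [Equiv.Perm.mclosure_swap_castSucc_succ]; trivial
    induction hσ using Submonoid.closure_induction generalizing w with
    | mem σ hσ =>
      obtain ⟨i, rfl⟩ := hσ
      exact iteratedFDeriv_comp_adjacent_swap hg i x w
    | one => rfl
    | mul σ τ _ _ h1 h2 =>
      rw [Equiv.Perm.coe_mul, ← Function.comp_assoc, h2, h1]

end Taylor

/-! ### Time derivatives of the derivatives of g along the solution. -/

section TimeDerivatives

variable {E : Type u} [NormedAddCommGroup E] [NormedSpace ℝ E]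

theorem iteratedDerivWithin_apply_const {S : Set ℝ} (hS : UniqueDiffOn ℝ S) {k ℓ : ℕ}
    {f : ℝ → E [×k]→L[ℝ] E} (hf : ContDiffOn ℝ ℓ f S) {t : ℝ} (ht : t ∈ S) (w : Fin k → E) :
    iteratedDerivWithin ℓ f S t w = iteratedDerivWithin ℓ (fun t => f t w) S t := by
  have := (ContinuousMultilinearMap.apply ℝ (fun _ : Fin k => E) E w).iteratedFDerivWithin_comp_left
    (hf t ht) hS ht le_rfl
  simp only [iteratedDerivWithin]
  change _ = iteratedFDerivWithin ℝ ℓ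
    (⇑(ContinuousMultilinearMap.apply ℝ (fun _ : Fin k => E) E w) ∘ f) S t fun _ => 1
  rw [this]
  rfl

end TimeDerivatives

section GDeriv

variable {E : Type u} [NormedAddCommGroup E] [InnerProductSpace ℝ E]
  {g : E → E} {S : Set ℝ} {y : ℝ → E} {r : ℕ}

theorem contDiffOn_iteratedFDeriv_comp (hg : ContDiff ℝ r g) (hy : ContDiffOn ℝ (r + 1 : ℕ) y S)
    {ℓ k : ℕ} (h : ℓ + k ≤ r) : ContDiffOn ℝ ℓ (fun t => iteratedFDeriv ℝ k g (y t)) S :=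
  (hg.iteratedFDeriv_right (by exact_mod_cast h)).comp_contDiffOn
    (hy.of_le (by exact_mod_cast (by omega : ℓ ≤ r + 1)))

theorem gDeriv_comp_perm (hg : ContDiff ℝ r g) (hy : ContDiffOn ℝ (r + 1 : ℕ) y S)
    (hS : UniqueDiffOn ℝ S) {ℓ k : ℕ} (h : ℓ + k ≤ r) {t : ℝ} (ht : t ∈ S)
    (w : Fin k → E) (σ : Equiv.Perm (Fin k)) :
    gDeriv g S y ℓ k t (w ∘ σ) = gDeriv g S y ℓ k t w := by
  have hf := contDiffOn_iteratedFDeriv_comp hg hy h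
  have hg' : ContDiff ℝ k g := hg.of_le (by exact_mod_cast (by omega : k ≤ r))
  rw [gDeriv, iteratedDerivWithin_apply_const hS hf ht, iteratedDerivWithin_apply_const hS hf ht]
  simp only [iteratedFDeriv_comp_perm hg']

/-- With the arguments $w$ frozen this is a derivative of a composition with $y$. The bound for
compositions asks for $\|y^{(i)}\|\le D^i$, which $D=\max(1,M)$ provides for $i\ge 1$. The case
$k=0$ is excluded because $g$ itself is not bounded. -/
theorem norm_gDeriv_le (hg : ContDiff ℝ r g) (hy : ContDiffOn ℝ (r + 1 : ℕ) y S)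
    (hS : UniqueDiffOn ℝ S) {M : ℝ}
    (hM : ∀ u : E, ∀ k ∈ Finset.Icc 1 r, ‖iteratedFDeriv ℝ k g u‖ ≤ M)
    (hyM : ∀ t ∈ S, ∀ k ∈ Finset.Icc 1 (r + 1), ‖iteratedDerivWithin k y S t‖ ≤ M)
    {ℓ k : ℕ} (hk : 1 ≤ k) (h : ℓ + k ≤ r) {t : ℝ} (ht : t ∈ S) :
    ‖gDeriv g S y ℓ k t‖ ≤ ℓ ! * M * max 1 M ^ ℓ := by
  have hM0 : 0 ≤ M := (norm_nonneg _).trans (hyM t ht 1 (Finset.mem_Icc.2 ⟨le_rfl, by omega⟩))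
  refine ContinuousMultilinearMap.opNorm_le_bound (by positivity) fun w => ?_
  rw [gDeriv, iteratedDerivWithin_apply_const hS (contDiffOn_iteratedFDeriv_comp hg hy h) ht,
    ← norm_iteratedFDerivWithin_eq_norm_iteratedDerivWithin, mul_right_comm, mul_assoc (ℓ ! : ℝ)]
  have hG : ContDiff ℝ ℓ fun u => iteratedFDeriv ℝ k g u w :=
    (ContinuousMultilinearMap.apply ℝ (fun _ : Fin k => E) E w).contDiff.comp
      (hg.iteratedFDeriv_right (by exact_mod_cast h))
  refine norm_iteratedFDerivWithin_comp_le (N := ℓ) (t := Set.univ)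
    (g := fun u => iteratedFDeriv ℝ k g u w) hG.contDiffOn
    (hy.of_le (by exact_mod_cast (by omega : ℓ ≤ r + 1))) le_rfl uniqueDiffOn_univ hS
    (Set.mapsTo_univ _ _) ht (fun i hi => ?_) (fun i hi hi' => ?_)
  · rw [iteratedFDerivWithin_univ]
    refine norm_iteratedFDeriv_iteratedFDeriv_apply_le (hg.of_le ?_) (fun u => hM _ _ ?_) _ _
    · exact_mod_cast (by omega : i + k ≤ r)
    · exact Finset.mem_Icc.2 ⟨by omega, by omega⟩
  · rw [norm_iteratedFDerivWithin_eq_norm_iteratedDerivWithin]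
    refine (hyM t ht i (Finset.mem_Icc.2 ⟨hi, by omega⟩)).trans ((le_max_right 1 M).trans ?_)
    exact le_self_pow₀ (le_max_left _ _) (by omega)

end GDeriv

/-! ### Solvability of the stage equations -/

section MapStages

variable {s : ℕ} {E : Type u}

/-- A map of `E`, applied stage by stage. -/
def mapStages (g : E → E) (U : Stages s E) : Stages s E := WithLp.toLp 2 fun i => g (U i)

@[simp] theorem mapStages_apply (g : E → E) (U : Stages s E) (i : Fin s) :
    mapStages g U i = g (U i) := rfl

theorem norm_mapStages_sub_le [NormedAddCommGroup E] {g : E → E} {L : ℝ} (hL : 0 ≤ L)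
    (hg : ∀ u v, ‖g u - g v‖ ≤ L * ‖u - v‖) (U V : Stages s E) :
    ‖mapStages g U - mapStages g V‖ ≤ s * L * ‖U - V‖ := by
  refine (norm_le_sum_stages _).trans ?_
  have : ∀ i ∈ Finset.univ, ‖(mapStages g U - mapStages g V) i‖ ≤ L * ‖U - V‖ := fun i _ =>
    (hg (U i) (V i)).trans (mul_le_mul_of_nonneg_left (norm_stage_le (U - V) i) hL)
  refine (Finset.sum_le_sum this).trans ?_
  simp [mul_assoc]

end MapStages

section Solvability

variable {s : ℕ} {E : Type u} [NormedAddCommGroup E] [InnerProductSpace ℝ E]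

@[simp] theorem kron_apply (B : Matrix (Fin s) (Fin s) ℝ) (Z : E →ₗ[ℝ] E) (U : Stages s E)
    (i : Fin s) : kron B Z U i = ∑ j, B i j • Z (U j) := rfl

@[simp] theorem kronVec_apply (β : Fin s → ℝ) (x : E) (i : Fin s) :
    kronVec β x i = β i • x := rfl

theorem kronRow_apply (β : Fin s → ℝ) (Z : E →ₗ[ℝ] E) (U : Stages s E) :
    kronRow β Z U = ∑ i, β i • Z (U i) := rfl

theorem norm_kron_id_le (B : Matrix (Fin s) (Fin s) ℝ) (U : Stages s E) :
    ‖kron B LinearMap.id U‖ ≤ (∑ i, ∑ j, |B i j|) * ‖U‖ := by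
  refine (norm_le_sum_stages _).trans ?_
  rw [Finset.sum_mul]
  refine Finset.sum_le_sum fun i _ => ?_
  rw [kron_apply, Finset.sum_mul]
  refine norm_sum_le_of_le _ fun j _ => ?_
  rw [norm_smul, Real.norm_eq_abs]
  exact mul_le_mul_of_nonneg_left (norm_stage_le U j) (abs_nonneg _)

theorem norm_kronRow_id_le (β : Fin s → ℝ) (U : Stages s E) :
    ‖kronRow β LinearMap.id U‖ ≤ (∑ i, |β i|) * ‖U‖ := by
  rw [kronRow_apply, Finset.sum_mul]
  refine norm_sum_le_of_le _ fun j _ => ?_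
  rw [norm_smul, Real.norm_eq_abs]
  exact mul_le_mul_of_nonneg_left (norm_stage_le U j) (abs_nonneg _)

theorem isStageSolution_iff (m : RKMethod s) (J : E →ₗ[ℝ] E) (g : E → E) (h : ℝ) (y₀ : E)
    (Y : Stages s E) : IsStageSolution m J g h y₀ Y ↔
      (1 - kron m.A (h • J)) Y
        = kronVec 1 y₀ + h • kron m.A LinearMap.id (mapStages g Y) := by
  rw [PiLp.ext_iff]
  refine forall_congr' fun i => ?_
  simp only [LinearMap.sub_apply, Module.End.one_apply, PiLp.sub_apply, kron_apply,
    LinearMap.smul_apply, PiLp.add_apply, kronVec_apply, Pi.one_apply, one_smul, PiLp.smul_apply,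
    LinearMap.id_apply, mapStages_apply, sub_eq_iff_eq_add, smul_add, Finset.sum_add_distrib]
  rw [show ∑ j, m.A i j • h • J (Y j) = h • ∑ j, m.A i j • J (Y j) by
    rw [Finset.smul_sum]; exact Finset.sum_congr rfl fun j _ => smul_comm _ _ _]
  rw [add_comm (h • ∑ j, m.A i j • J (Y j)), add_assoc]

theorem resolvent_apply_eq_iff {m : RKMethod s} {Z : E →ₗ[ℝ] E}
    (hu : IsUnit (1 - kron m.A Z)) (U V : Stages s E) :
    resolvent m Z U = V ↔ (1 - kron m.A Z) V = U := by
  constructor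
  · rintro rfl
    rw [resolvent, ← Module.End.mul_apply, Ring.mul_inverse_cancel _ hu, Module.End.one_apply]
  · rintro rfl
    rw [resolvent, ← Module.End.mul_apply, Ring.inverse_mul_cancel _ hu, Module.End.one_apply]

/-- The linear part is inverted first, so the fixed-point map is $Y\mapsto(I-A\otimes
Z)^{-1}(\mathbb 1\otimes y_0+h(A\otimes I)g(Y))$. Its contraction constant contains $L$ and the
resolvent bound, but not the size of $J$. -/
theorem existsUnique_stages [FiniteDimensional ℝ E] {m : RKMethod s} {J : E →ₗ[ℝ] E} {g : E → E}
    {h K L : ℝ} (hh : 0 ≤ h) (hK : 0 ≤ K) (hL : 0 ≤ L) (hu : IsUnit (1 - kron m.A (h • J)))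
    (hR : ∀ U, ‖resolvent m (h • J) U‖ ≤ K * ‖U‖) (hg : ∀ u v, ‖g u - g v‖ ≤ L * ‖u - v‖)
    (hsmall : h * (K * (∑ i, ∑ j, |m.A i j|) * (s * L)) < 1) (y₀ : E) :
    ∃! Y : Stages s E, IsStageSolution m J g h y₀ Y := by
  set Φ : Stages s E → Stages s E := fun Y =>
    resolvent m (h • J) (kronVec 1 y₀ + h • kron m.A LinearMap.id (mapStages g Y)) with hΦ
  have hiff : ∀ Y, IsStageSolution m J g h y₀ Y ↔ Φ Y = Y := fun Y => by
    rw [isStageSolution_iff, hΦ, resolvent_apply_eq_iff hu]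
  have hS : 0 ≤ ∑ i, ∑ j, |m.A i j| :=
    Finset.sum_nonneg fun i _ => Finset.sum_nonneg fun j _ => abs_nonneg _
  have hcontr : ContractingWith (Real.toNNReal (h * (K * (∑ i, ∑ j, |m.A i j|) * (s * L)))) Φ := by
    refine ⟨Real.toNNReal_lt_one.2 hsmall, LipschitzWith.of_dist_le_mul fun U V => ?_⟩
    rw [Real.coe_toNNReal _ (by positivity), dist_eq_norm, dist_eq_norm, hΦ]
    simp only []
    rw [← map_sub, add_sub_add_left_eq_sub, ← smul_sub, ← map_sub]
    refine (hR _).trans ?_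
    rw [norm_smul, Real.norm_eq_abs, abs_of_nonneg hh]
    have h1 := norm_kron_id_le m.A (mapStages g U - mapStages g V)
    have h2 := norm_mapStages_sub_le hL hg U V
    calc K * (h * ‖kron m.A LinearMap.id (mapStages g U - mapStages g V)‖)
        ≤ K * (h * ((∑ i, ∑ j, |m.A i j|) * (s * L * ‖U - V‖))) := by
          gcongr; exact h1.trans (by gcongr)
      _ = h * (K * (∑ i, ∑ j, |m.A i j|) * (s * L)) * ‖U - V‖ := by ring
  have : CompleteSpace (Stages s E) := FiniteDimensional.complete ℝ _
  refine ⟨hcontr.fixedPoint Φ, (hiff _).2 hcontr.fixedPoint_isFixedPt, fun Y hY => ?_⟩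
  exact hcontr.fixedPoint_unique ((hiff Y).1 hY)

end Solvability

/-! ### Dissipativity from the logarithmic norm. -/

section LogNorm

variable {E : Type u} [NormedAddCommGroup E] [InnerProductSpace ℝ E] [FiniteDimensional ℝ E]

theorem dissipative_of_logNorm_nonpos {J : E →ₗ[ℝ] E} (h : logNorm J ≤ 0) : Dissipative J := by
  intro x
  rcases eq_or_ne x 0 with rfl | hx
  · simp
  have hcont : Continuous fun x : E => inner ℝ x (J x) :=
    continuous_id.inner J.continuous_of_finiteDimensional
  -- Without boundedness the real `sSup` would take the default value zero and say nothing about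
  -- $J$; compactness of the unit sphere excludes this.
  have hbdd : BddAbove ((fun x : E => inner ℝ x (J x)) '' Metric.sphere 0 1) :=
    ((isCompact_sphere (0 : E) 1).image hcont).bddAbove
  have hx' : ‖x‖ ≠ 0 := norm_ne_zero_iff.2 hx
  have hmem : ‖x‖⁻¹ • x ∈ Metric.sphere (0 : E) 1 := by
    rw [mem_sphere_zero_iff_norm, norm_smul, norm_inv, norm_norm, inv_mul_cancel₀ hx']
  have h1 := (le_csSup hbdd (Set.mem_image_of_mem _ hmem)).trans h
  simp only [map_smul, inner_smul_left, inner_smul_right] at h1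
  have h2 : 0 < ‖x‖⁻¹ := by positivity
  have h3 : ‖x‖⁻¹ * (‖x‖⁻¹ * inner ℝ x (J x)) ≤ 0 := by simpa using h1
  by_contra hpos
  have := mul_pos h2 (mul_pos h2 (not_le.1 hpos))
  linarith

end LogNorm

/-! ### Combinatorics of rooted trees -/

namespace PlaneTree

/-- The constructor `child` replaces only the first child, so each child is moved to the front,
replaced and moved back. The prefix `p` holds the children already treated. -/
theorem equivalent_node_of_forall₂ {l l' : List PlaneTree} (h : List.Forall₂ Equivalent l l')
    (p : List PlaneTree) : Equivalent (node (p ++ l)) (node (p ++ l')) := by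
  induction h generalizing p with
  | nil => exact .refl _
  | @cons a b t t' hab _ ih =>
    have h1 : Equivalent (node (p ++ a :: t)) (node (p ++ b :: t)) :=
      (Equivalent.perm List.perm_middle).trans
        ((Equivalent.child _ hab).trans (Equivalent.perm List.perm_middle.symm))
    have h2 := ih (p ++ [b])
    rw [List.append_assoc, List.append_assoc] at h2
    exact h1.trans h2

end PlaneTree

namespace RTree

open PlaneTree

/-- The rooted tree of a plane tree. -/
def mk (t : PlaneTree) : RTree := Quotient.mk PlaneTree.setoid t

/-- A plane tree representing a rooted tree. -/
def rep (τ : RTree) : PlaneTree := Quotient.out (s := PlaneTree.setoid) τ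

theorem mk_rep (τ : RTree) : mk τ.rep = τ := Quotient.out_eq (s := PlaneTree.setoid) τ

theorem equivalent_rep_mk (t : PlaneTree) : Equivalent (mk t).rep t :=
  Quotient.mk_out (s := PlaneTree.setoid) t

theorem mk_eq {t u : PlaneTree} (h : Equivalent t u) : mk t = mk u := Quotient.sound h

theorem exists_mk_node (τ : RTree) : ∃ l, mk (node l) = τ := by
  rw [← mk_rep τ]
  obtain ⟨l⟩ := τ.rep
  exact ⟨l, rfl⟩

theorem children_mk (l : List PlaneTree) :
    children (mk (node l)) = ((l.map mk : List RTree) : Multiset RTree) := rfl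

theorem mk_node_rep_map (l : List PlaneTree) : mk (node l) = mk (node ((l.map mk).map rep)) := by
  refine mk_eq (equivalent_node_of_forall₂ (p := []) ?_)
  induction l with
  | nil => exact .nil
  | cons a l ih => exact .cons (equivalent_rep_mk a).symm ih

/-- Replacing every subtree by the chosen representative of its class turns equality of multisets of
classes into a permutation of lists of plane trees. -/
theorem children_injective : Function.Injective children := by
  intro τ σ h
  obtain ⟨l, rfl⟩ := exists_mk_node τ
  obtain ⟨l', rfl⟩ := exists_mk_node σ
  rw [children_mk, children_mk, Multiset.coe_eq_coe] at h
  rw [mk_node_rep_map l, mk_node_rep_map l']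
  exact mk_eq (Equivalent.perm (h.map rep))

theorem children_surjective : Function.Surjective children := by
  intro B
  induction B using Quotient.inductionOn with | h l =>
  refine ⟨mk (node (l.map rep)), ?_⟩
  rw [children_mk, List.map_map]
  simp [Function.comp_def, mk_rep]

theorem order_eq_children (τ : RTree) : τ.order = 1 + (τ.children.map order).sum := by
  obtain ⟨l, rfl⟩ := exists_mk_node τ
  rw [children_mk, Multiset.map_coe, Multiset.sum_coe, List.map_map]
  change PlaneTree.size _ = _
  simp only [PlaneTree.size]
  rfl

theorem children_leaf : leaf.children = 0 := rfl

theorem order_leaf : leaf.order = 1 := by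
  rw [order_eq_children, children_leaf]; simp

theorem one_le_order (τ : RTree) : 1 ≤ τ.order := by
  rw [order_eq_children]; omega

theorem children_eq (τ : RTree) :
    τ.children = Multiset.replicate τ.leafCount leaf + τ.branches := by
  classical
  rw [leafCount, branches, ← Multiset.filter_eq']
  convert (Multiset.filter_add_not (· = leaf) τ.children).symm using 2

theorem order_eq (τ : RTree) : τ.order = 1 + τ.leafCount + (τ.branches.map order).sum := by
  rw [order_eq_children, children_eq]
  simp [order_leaf, add_assoc]

theorem leaf_notMem_branches (τ : RTree) : leaf ∉ τ.branches := by
  classical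
  simp [branches]

theorem ext_of_branches {τ σ : RTree} (h : τ.leafCount = σ.leafCount)
    (h' : τ.branches = σ.branches) : τ = σ :=
  children_injective (by rw [children_eq, children_eq σ, h, h'])

/-- Together with `ext_of_branches`, this makes the pair of leaf count and branches a faithful
coordinate system for trees: every number and every multiset avoiding the one-vertex tree occur
exactly once. -/
theorem exists_tree (ℓ : ℕ) {B : Multiset RTree} (hB : leaf ∉ B) :
    ∃ τ : RTree, τ.leafCount = ℓ ∧ τ.branches = B := by
  classical
  obtain ⟨τ, hτ⟩ := children_surjective (Multiset.replicate ℓ leaf + B)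
  refine ⟨τ, ?_, ?_⟩
  · rw [leafCount, hτ, Multiset.count_add, Multiset.count_eq_zero_of_notMem hB]
    simp
  · rw [branches, hτ, Multiset.filter_add]
    have h1 : Multiset.filter (· ≠ leaf) (Multiset.replicate ℓ leaf) = 0 :=
      Multiset.filter_eq_nil.2 fun a ha => by simp [Multiset.eq_of_mem_replicate ha]
    have h2 : Multiset.filter (· ≠ leaf) B = B :=
      Multiset.filter_eq_self.2 fun a ha h => hB (h ▸ ha)
    convert zero_add B using 2

theorem card_le_sum_order (B : Multiset RTree) : Multiset.card B ≤ (B.map order).sum := by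
  induction B using Multiset.induction_on with
  | empty => simp
  | cons a B ih =>
    have := one_le_order a
    simp only [Multiset.card_cons, Multiset.map_cons, Multiset.sum_cons]; omega

theorem leafCount_leaf : leaf.leafCount = 0 := by
  have := order_eq leaf; rw [order_leaf] at this; omega

theorem branches_leaf : leaf.branches = 0 := by
  have h := order_eq leaf
  have := card_le_sum_order leaf.branches
  rw [order_leaf] at h
  exact Multiset.card_eq_zero.1 (by omega)

theorem mem_upTo {r : ℕ} {τ : RTree} : τ ∈ upTo r ↔ τ.order ≤ r := by
  simp [upTo]

theorem zeta_of_branches_eq_zero {τ : RTree} (h : τ.branches = 0) : τ.zeta = 1 := by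
  rw [zeta, if_pos h]

open Classical in
theorem zeta_of_branches_ne_zero {τ : RTree} (h : τ.branches ≠ 0) :
    τ.zeta = (-1 : ℝ) ^ (Multiset.card τ.branches + 1)
        / ((Multiset.card τ.branches)! * (τ.leafCount)!)
      * ((Multiset.card τ.branches)! / ∏ σ ∈ τ.branches.toFinset, ((τ.branches.count σ)! : ℝ))
      * (τ.branches.map zeta).prod := by
  rw [zeta, if_neg h]
  congr 2
  exact Multiset.attach_map_val' τ.branches zeta

end RTree

/-! ### Arrangements of a multiset. -/

section Counting

open Finset

variable {ι : Type*}

/-- Over each value the two maps have fibres of equal size; bijections of the fibres are glued to a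
permutation. -/
theorem exists_perm_of_map_univ_eq {k : ℕ} {f f₀ : Fin k → ι}
    (h : (univ : Finset (Fin k)).val.map f = univ.val.map f₀) :
    ∃ σ : Equiv.Perm (Fin k), f = f₀ ∘ σ := by
  classical
  have hcard : ∀ i, Nonempty ({a // f a = i} ≃ {a // f₀ a = i}) := fun i => by
    refine ⟨Fintype.equivOfCardEq ?_⟩
    have := congrArg (Multiset.count i) h
    rw [Multiset.count_map, Multiset.count_map] at this
    rw [Fintype.card_subtype, Fintype.card_subtype]
    simp only [Finset.card, Finset.filter_val, eq_comm (b := i)]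
    exact this
  refine ⟨(Equiv.sigmaFiberEquiv f).symm.trans ((Equiv.sigmaCongrRight fun i =>
    (hcard i).some).trans (Equiv.sigmaFiberEquiv f₀)), ?_⟩
  funext a
  simp only [Function.comp_apply, Equiv.trans_apply]
  exact (((hcard (f a)).some) ⟨a, rfl⟩).2.symm

open Classical in
/-- The number of arrangements of a multiset. -/
theorem card_filter_map_eq {k : ℕ} {S : Finset (Fin k → ι)} {B : Multiset ι}
    (hB : Multiset.card B = k)
    (hS : ∀ f : Fin k → ι, f ∈ S ↔ univ.val.map f = B) :
    (#S : ℝ) = k ! / ∏ σ ∈ B.toFinset, ((B.count σ)! : ℝ) := by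
  obtain ⟨f₀, hf₀⟩ : ∃ f₀ : Fin k → ι, univ.val.map f₀ = B := by
    subst hB
    refine ⟨fun i => B.toList.get (i.cast (Multiset.length_toList B).symm), ?_⟩
    have : (List.ofFn fun i : Fin (Multiset.card B) =>
        B.toList.get (i.cast (Multiset.length_toList B).symm)) = B.toList := by
      apply List.ext_get
      · simp
      · intro n h1 h2; simp
    conv_rhs => rw [← Multiset.coe_toList B, ← this]
    rw [Fin.univ_val_map]
  -- Orbit counting: the arrangements form the orbit of one arrangement under permutations of the
  -- positions. All fibres of the orbit map have the size of the stabilizer, the product of the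
  -- factorials of the multiplicities.
  have himg : S = univ.image fun σ : Equiv.Perm (Fin k) => f₀ ∘ σ := by
    ext f
    rw [hS, ← hf₀]
    constructor
    · intro h
      obtain ⟨σ, rfl⟩ := exists_perm_of_map_univ_eq h
      exact mem_image_of_mem _ (mem_univ _)
    · intro h
      obtain ⟨σ, -, rfl⟩ := mem_image.1 h
      rw [← Multiset.map_map]
      congr 1
      exact congrArg Finset.val (Finset.map_univ_equiv σ)
  have hprod : ∏ σ ∈ B.toFinset, (B.count σ)!
      = #{σ : Equiv.Perm (Fin k) | f₀ ∘ σ = f₀} := by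
    rw [← Fintype.card_subtype, DomMulAct.stabilizer_card']
    refine prod_congr ?_ fun i _ => ?_
    · ext i; simp [← hf₀]
    · rw [← hf₀, Multiset.count_map, Fintype.card_subtype]
      simp only [Finset.card, Finset.filter_val, eq_comm (b := i)]
  have hfib : ∀ f ∈ S, #{σ : Equiv.Perm (Fin k) | f₀ ∘ σ = f}
      = #{σ : Equiv.Perm (Fin k) | f₀ ∘ σ = f₀} := by
    intro f hf
    rw [himg] at hf
    obtain ⟨τ, -, rfl⟩ := mem_image.1 hf
    refine card_bij' (fun σ _ => σ * τ⁻¹) (fun σ _ => σ * τ) ?_ ?_ ?_ ?_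
    · intro σ hσ
      simp only [mem_filter, mem_univ, true_and] at hσ ⊢
      rw [Equiv.Perm.coe_mul, ← Function.comp_assoc, hσ, Function.comp_assoc,
        ← Equiv.Perm.coe_mul]
      simp
    · intro σ hσ
      simp only [mem_filter, mem_univ, true_and] at hσ ⊢
      rw [Equiv.Perm.coe_mul, ← Function.comp_assoc, hσ]
    · intro σ _; simp
    · intro σ _; simp
  have htot : k ! = #S * ∏ σ ∈ B.toFinset, (B.count σ)! := by
    have h1 := card_eq_sum_card_fiberwise (f := fun σ : Equiv.Perm (Fin k) => f₀ ∘ σ)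
      (s := univ) (t := S)
      (fun σ _ => by rw [himg]; exact mem_coe.2 (mem_image_of_mem _ (mem_univ σ)))
    rw [sum_congr rfl hfib, sum_const, smul_eq_mul, card_univ, Fintype.card_perm,
      Fintype.card_fin, ← hprod] at h1
    exact h1
  have hpos : (∏ σ ∈ B.toFinset, ((B.count σ)! : ℝ)) ≠ 0 :=
    prod_ne_zero_iff.2 fun σ _ => by positivity
  rw [eq_div_iff hpos]
  exact_mod_cast htot.symm

end Counting

/-! ### From sums over sequences of trees to sums over trees. -/

section Regrouping

open Finset RTree

variable {V : Type v} [AddCommGroup V]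

theorem RTree.map_get_branchList (τ : RTree) :
    (univ : Finset (Fin τ.branchList.length)).val.map τ.branchList.get = τ.branches := by
  rw [Fin.univ_val_map, List.ofFn_get, branchList, Multiset.coe_toList]

theorem RTree.length_branchList (τ : RTree) :
    τ.branchList.length = Multiset.card τ.branches := Multiset.length_toList _

/-- The coefficient of a sequence of branches in the expansion. -/
def seqCoeff (ℓ k : ℕ) (f : Fin k → RTree) : ℝ :=
  (-1 : ℝ) ^ (k + 1) / (k ! * ℓ !) * ∏ j, (f j).zeta

/-- The order of the tree `[τ₀^ℓ f₁ ⋯ f_k]`. -/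
def seqOrder (ℓ k : ℕ) (f : Fin k → RTree) : ℕ := 1 + ℓ + ∑ j, (f j).order

theorem seqOrder_eq {ℓ k : ℕ} {f : Fin k → RTree} {τ : RTree} (hℓ : τ.leafCount = ℓ)
    (hf : (univ : Finset (Fin k)).val.map f = τ.branches) : seqOrder ℓ k f = τ.order := by
  rw [seqOrder, order_eq, hℓ, ← hf, Multiset.map_map]; rfl

-- Each tree with $k$ branches arises from $k!/\prod\mu_i!$ sequences, the factor by which `zeta`
-- differs from `seqCoeff`. Sequences containing the one-vertex tree are no list of branches in
-- standardized form; they drop out because their terms vanish. Branches of a tree of order at most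
-- `q` have order at most `q - 1`, whence the range of summation.
open Classical in
theorem sum_seq_eq_sum_trees [Module ℝ V] {q k ℓ : ℕ} (hk : 1 ≤ k)
    (T : (Fin k → RTree) → V) (T' : RTree → V)
    (hT : ∀ τ f, τ.order ≤ q → (univ : Finset (Fin k)).val.map f = τ.branches →
      τ.leafCount = ℓ → T f = T' τ)
    (h0 : ∀ f, (∃ j, f j = leaf) → T f = 0) :
    ∑ f ∈ (Fintype.piFinset fun _ : Fin k => upTo (q - 1)) with seqOrder ℓ k f ≤ q,
        seqCoeff ℓ k f • T f
      = ∑ τ ∈ upTo q with Multiset.card τ.branches = k ∧ τ.leafCount = ℓ, τ.zeta • T' τ := by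
  set S := (Fintype.piFinset fun _ : Fin k => upTo (q - 1)).filter
    (fun f => seqOrder ℓ k f ≤ q) with hS
  have hleaf : ∀ f : Fin k → RTree, (∀ j, f j ≠ leaf) → leaf ∉ univ.val.map f := by
    intro f hf hmem
    obtain ⟨j, -, hj⟩ := Multiset.mem_map.1 hmem
    exact hf j hj
  have hgraft : ∀ f : Fin k → RTree, ∃ τ : RTree, (∀ j, f j ≠ leaf) →
      τ.leafCount = ℓ ∧ τ.branches = univ.val.map f := by
    intro f
    by_cases hf : ∀ j, f j ≠ leaf
    · obtain ⟨τ, hτ⟩ := exists_tree ℓ (hleaf f hf)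
      exact ⟨τ, fun _ => hτ⟩
    -- A default value: sequences with a one-vertex entry have already been discarded wherever `G`
    -- is used.
    · exact ⟨leaf, fun h => absurd h hf⟩
  choose G hG using hgraft
  have h1 : ∑ f ∈ S, seqCoeff ℓ k f • T f
      = ∑ f ∈ S with (∀ j, f j ≠ leaf), seqCoeff ℓ k f • T f := by
    refine (sum_filter_of_ne fun f _ hne j hj => hne ?_).symm
    rw [h0 f ⟨j, hj⟩, smul_zero]
  have h2 : ∀ f ∈ S.filter (fun f => ∀ j, f j ≠ leaf),
      G f ∈ (upTo q).filter (fun τ => Multiset.card τ.branches = k ∧ τ.leafCount = ℓ) := by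
    intro f hf
    simp only [hS, mem_filter] at hf
    obtain ⟨hℓ, hb⟩ := hG f hf.2
    rw [mem_filter, mem_upTo, ← seqOrder_eq hℓ hb.symm, hb]
    exact ⟨hf.1.2, by simp, hℓ⟩
  rw [h1, ← sum_fiberwise_of_maps_to h2]
  refine sum_congr rfl fun τ hτ => ?_
  rw [mem_filter, mem_upTo] at hτ
  obtain ⟨hτq, hτk, hτℓ⟩ := hτ
  have hmem : ∀ f, f ∈ (S.filter fun f => ∀ j, f j ≠ leaf).filter (fun f => G f = τ) ↔
      univ.val.map f = τ.branches := by
    intro f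
    simp only [hS, mem_filter, Fintype.mem_piFinset, mem_upTo]
    constructor
    · rintro ⟨⟨-, hf⟩, rfl⟩
      exact (hG f hf).2.symm
    · intro hf
      have hj : ∀ j, f j ∈ τ.branches := fun j => by
        rw [← hf]; exact Multiset.mem_map_of_mem f (mem_univ j)
      have hnl : ∀ j, f j ≠ leaf := fun j h => τ.leaf_notMem_branches (h ▸ hj j)
      refine ⟨⟨⟨fun j => ?_, ?_⟩, hnl⟩, ?_⟩
      · have := order_lt_of_mem_branches (hj j); omega
      · rwa [seqOrder_eq hτℓ hf]
      · exact ext_of_branches ((hG f hnl).1.trans hτℓ.symm) ((hG f hnl).2.trans hf)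
  have hne : τ.branches ≠ 0 := fun h => by rw [h, Multiset.card_zero] at hτk; omega
  have hterm : ∀ f ∈ (S.filter fun f => ∀ j, f j ≠ leaf).filter (fun f => G f = τ),
      seqCoeff ℓ k f • T f
        = ((-1 : ℝ) ^ (k + 1) / (k ! * ℓ !) * (τ.branches.map zeta).prod) • T' τ := by
    intro f hf
    have hf' := (hmem f).1 hf
    rw [hT τ f hτq hf' hτℓ, seqCoeff, ← hf', Multiset.map_map]
    rfl
  rw [sum_congr rfl hterm, sum_const, ← Nat.cast_smul_eq_nsmul ℝ, smul_smul,
    card_filter_map_eq hτk hmem, zeta_of_branches_ne_zero hne, hτk, hτℓ]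
  congr 1
  ring

-- The order of a tree is at least $1+\ell+k$, so these ranges of $k$ and $\ell$ exhaust the trees.
-- Branches have order at least two and smaller ranges would do, but these are the ranges that the
-- Taylor expansions produce.
open Classical in
theorem sum_trees_by_shape (q : ℕ) (F : RTree → V) :
    ∑ k ∈ Ico 1 q, ∑ ℓ ∈ range (q - k),
        ∑ τ ∈ upTo q with Multiset.card τ.branches = k ∧ τ.leafCount = ℓ, F τ
      = ∑ τ ∈ upTo q with τ.branches ≠ 0, F τ := by
  have hmap : ∀ τ ∈ (upTo q).filter (fun τ => τ.branches ≠ 0),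
      Multiset.card τ.branches ∈ Ico 1 q := by
    intro τ hτ
    rw [mem_filter, mem_upTo] at hτ
    have h1 := order_eq τ
    have h2 := card_le_sum_order τ.branches
    have h3 := Multiset.card_pos.2 hτ.2
    rw [mem_Ico]; omega
  rw [← sum_fiberwise_of_maps_to hmap]
  refine sum_congr rfl fun k hk => ?_
  rw [mem_Ico] at hk
  have hmap2 : ∀ τ ∈ ((upTo q).filter (fun τ => τ.branches ≠ 0)).filter
      (fun τ => Multiset.card τ.branches = k), τ.leafCount ∈ range (q - k) := by
    intro τ hτ
    rw [mem_filter, mem_filter, mem_upTo] at hτ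
    have h1 := order_eq τ
    have h2 := card_le_sum_order τ.branches
    rw [mem_range]; omega
  rw [← sum_fiberwise_of_maps_to hmap2]
  refine sum_congr rfl fun ℓ _ => sum_congr ?_ fun _ _ => rfl
  ext τ
  simp only [mem_filter]
  constructor
  · rintro ⟨h1, h2, h3⟩
    refine ⟨⟨⟨h1, fun h => ?_⟩, h2⟩, h3⟩
    rw [h, Multiset.card_zero] at h2; omega
  · rintro ⟨⟨⟨h1, -⟩, h2⟩, h3⟩
    exact ⟨h1, h2, h3⟩

open Classical in
theorem sum_bushes (q : ℕ) (F : ℕ → V) :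
    ∑ τ ∈ upTo q with τ.branches = 0, F τ.leafCount = ∑ ℓ ∈ range q, F ℓ := by
  refine sum_nbij leafCount ?_ ?_ ?_ fun _ _ => rfl
  · intro τ hτ
    rw [mem_filter, mem_upTo] at hτ
    have h1 := order_eq τ
    rw [mem_range]; omega
  · intro τ hτ σ hσ h
    rw [mem_coe, mem_filter] at hτ hσ
    exact ext_of_branches h (hτ.2.trans hσ.2.symm)
  · intro ℓ hℓ
    rw [mem_coe, mem_range] at hℓ
    obtain ⟨τ, h1, h2⟩ := exists_tree ℓ (B := 0) (by simp)
    refine ⟨τ, ?_, h1⟩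
    rw [mem_coe, mem_filter, mem_upTo]
    refine ⟨?_, h2⟩
    rw [order_eq, h1, h2]; simp; omega

theorem upTo_zero : upTo 0 = ∅ := by
  refine Finset.eq_empty_of_forall_notMem fun τ hτ => ?_
  have := one_le_order τ
  rw [mem_upTo] at hτ; omega

open Classical in
theorem sum_trees_eq [Module ℝ V] (q : ℕ) (h : ℝ) (F : RTree → V)
    (B : ℕ → V) (hB : ∀ τ : RTree, τ.branches = 0 → F τ = B τ.leafCount) :
    ∑ τ ∈ upTo q, (τ.zeta * h ^ τ.order) • F τ
      = ∑ ℓ ∈ Finset.range q, h ^ (ℓ + 1) • B ℓ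
        + ∑ τ ∈ upTo q with τ.branches ≠ 0, (τ.zeta * h ^ τ.order) • F τ := by
  rw [← Finset.sum_filter_add_sum_filter_not (upTo q) (fun τ => τ.branches = 0), ← sum_bushes]
  congr 1
  refine Finset.sum_congr rfl fun τ hτ => ?_
  have hb := (Finset.mem_filter.1 hτ).2
  rw [zeta_of_branches_eq_zero hb, one_mul, hB τ hb, order_eq, hb]
  simp [add_comm]

end Regrouping

/-! ### Uniform orders of magnitude -/

/-- `f` is of order `h^n`, uniformly over a family of problems with step sizes `h`. The values of
`f` may lie in spaces that vary with the problem. -/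
def UnifO {P : Type u} (h : P → ℝ) (n : ℕ) {F : P → Type v} [∀ p, Norm (F p)] (f : ∀ p, F p) :
    Prop := ∃ C : ℝ, 0 ≤ C ∧ ∀ p, ‖f p‖ ≤ C * h p ^ n

namespace UnifO

variable {P : Type u} {h : P → ℝ} {n k : ℕ} {F : P → Type v} [∀ p, NormedAddCommGroup (F p)]
  {f f' : ∀ p, F p}

theorem of_bound (h0 : ∀ p, 0 ≤ h p) (C : ℝ) (H : ∀ p, ‖f p‖ ≤ C * h p ^ n) : UnifO h n f :=
  ⟨|C|, abs_nonneg C, fun p => (H p).trans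
    (mul_le_mul_of_nonneg_right (le_abs_self C) (pow_nonneg (h0 p) n))⟩

theorem congr (hf : UnifO h n f) (e : ∀ p, f p = f' p) : UnifO h n f' := by
  rwa [funext e] at hf

theorem add (hf : UnifO h n f) (hf' : UnifO h n f') :
    UnifO h n fun p => f p + f' p := by
  obtain ⟨C, hC, H⟩ := hf
  obtain ⟨C', hC', H'⟩ := hf'
  refine ⟨C + C', add_nonneg hC hC', fun p => ?_⟩
  rw [add_mul]
  exact (norm_add_le _ _).trans (add_le_add (H p) (H' p))

theorem neg (hf : UnifO h n f) : UnifO h n fun p => -f p := by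
  obtain ⟨C, hC, H⟩ := hf
  exact ⟨C, hC, fun _ => by rw [norm_neg]; exact H _⟩

theorem sub (hf : UnifO h n f) (hf' : UnifO h n f') :
    UnifO h n fun p => f p - f' p :=
  (hf.add hf'.neg).congr fun _ => (sub_eq_add_neg _ _).symm

theorem zero : UnifO h n fun p : P => (0 : F p) := ⟨0, le_rfl, fun _ => by simp⟩

theorem sum {ι : Type*} (s : Finset ι) {f : ι → ∀ p, F p}
    (hf : ∀ i ∈ s, UnifO h n (f i)) : UnifO h n fun p => ∑ i ∈ s, f i p := by
  classical
  induction s using Finset.induction_on with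
  | empty => exact zero.congr fun p => by simp
  | insert a s ha ih =>
    refine ((hf a (Finset.mem_insert_self a s)).add
      (ih fun i hi => hf i (Finset.mem_insert_of_mem hi))).congr fun p => ?_
    rw [Finset.sum_insert ha]

theorem mono (h0 : ∀ p, 0 ≤ h p) (h1 : ∀ p, h p ≤ 1) (hf : UnifO h n f) (hk : k ≤ n) :
    UnifO h k f := by
  obtain ⟨C, hC, H⟩ := hf
  exact ⟨C, hC, fun p => (H p).trans
    (mul_le_mul_of_nonneg_left (pow_le_pow_of_le_one (h0 p) (h1 p) hk) hC)⟩

theorem of_le {F' : P → Type*} [∀ p, NormedAddCommGroup (F' p)] {f' : ∀ p, F' p}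
    (hf : UnifO h n f) {K : ℝ} (hK : 0 ≤ K) (H : ∀ p, ‖f' p‖ ≤ K * ‖f p‖) : UnifO h n f' := by
  obtain ⟨C, hC, H'⟩ := hf
  refine ⟨K * C, mul_nonneg hK hC, fun p => ?_⟩
  rw [mul_assoc]
  exact (H p).trans (mul_le_mul_of_nonneg_left (H' p) hK)

theorem const_smul [∀ p, NormedSpace ℝ (F p)] (hf : UnifO h n f) (c : ℝ) :
    UnifO h n fun p => c • f p :=
  hf.of_le (abs_nonneg c) fun p => by rw [norm_smul, Real.norm_eq_abs]

theorem pow_smul [∀ p, NormedSpace ℝ (F p)] (h0 : ∀ p, 0 ≤ h p) (hf : UnifO h n f) (k : ℕ) :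
    UnifO h (n + k) fun p => h p ^ k • f p := by
  obtain ⟨C, hC, H⟩ := hf
  refine ⟨C, hC, fun p => ?_⟩
  rw [norm_smul, norm_pow, Real.norm_eq_abs, abs_of_nonneg (h0 p), pow_add, ← mul_assoc,
    mul_comm (h p ^ k)]
  exact mul_le_mul_of_nonneg_right (H p) (pow_nonneg (h0 p) k)

theorem smul [∀ p, NormedSpace ℝ (F p)] (h0 : ∀ p, 0 ≤ h p) (hf : UnifO h n f) :
    UnifO h (n + 1) fun p => h p • f p :=
  (hf.pow_smul h0 1).congr fun p => by rw [pow_one]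

theorem of_stages {s : ℕ} {E : P → Type v} [∀ p, NormedAddCommGroup (E p)]
    {U : ∀ p, Stages s (E p)} (hU : ∀ i, UnifO h n fun p => U p i) :
    UnifO h n U := by
  choose C hC H using hU
  refine ⟨∑ i, C i, Finset.sum_nonneg fun i _ => hC i, fun p => ?_⟩
  rw [Finset.sum_mul]
  exact (norm_le_sum_stages _).trans (Finset.sum_le_sum fun i _ => H i p)

theorem stage {s : ℕ} {E : P → Type v} [∀ p, NormedAddCommGroup (E p)]
    {U : ∀ p, Stages s (E p)} (hU : UnifO h n U) (i : Fin s) : UnifO h n fun p => U p i := by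
  obtain ⟨C, hC, H⟩ := hU
  exact ⟨C, hC, fun p => (norm_stage_le _ i).trans (H p)⟩

end UnifO

/-! ### Families of steps -/

/-- A Runge-Kutta step from an exact value, together with the resolvent bounds that are available
for a stable method. -/
structure StepData {s : ℕ} (m : RKMethod s) (L M K : ℝ) (r : ℕ) where
  E : Type u
  [normed : NormedAddCommGroup E]
  [innerProduct : InnerProductSpace ℝ E]
  J : E →ₗ[ℝ] E
  g : E → E
  y : ℝ → E
  ta : ℝ
  tf : ℝ
  t₀ : ℝ
  h : ℝ
  Y : Stages s E
  sol : IsSemilinearSolution r L M J g (Set.Icc ta tf) y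
  t₀_mem : t₀ ∈ Set.Icc ta tf
  h_pos : 0 < h
  h_le_one : h ≤ 1
  small : h * (K * (∑ i, ∑ j, |m.A i j|) * (s * L)) ≤ 1 / 2
  h_mem : t₀ + h ∈ Set.Icc ta tf
  c_mem : ∀ i, t₀ + m.c i * h ∈ Set.Icc ta tf
  stage : IsStageSolution m J g h (y t₀) Y
  unit : IsUnit (1 - kron m.A (h • J))
  bound : ∀ U, ‖resolvent m (h • J) U‖ ≤ K * ‖U‖
  bound' : ∀ U, ‖kronRow m.b (h • J) (resolvent m (h • J) U)‖ ≤ K * ‖U‖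

namespace StepData

attribute [instance] normed innerProduct

variable {s : ℕ} {m : RKMethod s} {L M K : ℝ} {r : ℕ} (p : StepData.{u} m L M K r)

/-- The time interval of the solution. -/
abbrev I : Set ℝ := Set.Icc p.ta p.tf

/-- The operator `Z = h J`. -/
abbrev Z : p.E →ₗ[ℝ] p.E := p.h • p.J

/-- The derivatives of the solution at the beginning of the step. -/
abbrev yd (k : ℕ) : p.E := iteratedDerivWithin k p.y p.I p.t₀

/-- The exact solution at the abscissae. -/
abbrev X : Stages s p.E := exactStages m p.y p.t₀ p.h

/-- The vector field along the exact solution at the abscissae. -/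
def field (j : Fin s) : p.E := p.J (p.X j) + p.g (p.X j)

/-- The stage error. -/
def δ : Stages s p.E := p.X - p.Y

/-- The difference of the nonlinearity at the exact and at the numerical stages. -/
def Δ : Stages s p.E := mapStages p.g p.X - mapStages p.g p.Y

/-- The stage elementary differentials at the beginning of the step. -/
abbrev Ψ (τ : RTree) : Stages s p.E := stagePsi m p.g p.I p.y p.Z p.t₀ τ

/-- The defect of the stage equations for the exact solution. -/
def defect : Stages s p.E :=
  WithLp.toLp 2 fun i => p.X i - p.y p.t₀ - p.h • ∑ j, m.A i j • p.field j

/-- The defect of the step for the exact solution. -/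
def stepDefect : p.E := p.y (p.t₀ + p.h) - p.y p.t₀ - p.h • ∑ j, m.b j • p.field j

theorem h_nonneg : 0 ≤ p.h := p.h_pos.le

/-- Both $t_0$ and $t_0+h$ lie in the interval, so $h>0$ keeps it from being a single point. -/
theorem uniqueDiffOn : UniqueDiffOn ℝ p.I :=
  uniqueDiffOn_Icc (by linarith [p.t₀_mem.1, p.h_mem.2, p.h_pos])

theorem M_nonneg (p : StepData.{u} m L M K r) : 0 ≤ M := (norm_nonneg _).trans
  (p.sol.bound_y p.t₀ p.t₀_mem 1 (Finset.mem_Icc.2 ⟨le_rfl, by omega⟩))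

/-- Along the exact solution the stiff vector field is $y'$, so its expansion is controlled by the
bounds on $y$ and never by $J$. -/
theorem field_eq (j : Fin s) :
    p.field j = iteratedDerivWithin 1 p.y p.I (p.t₀ + m.c j * p.h) := by
  rw [iteratedDerivWithin_one]
  exact ((p.sol.hasDeriv _ (p.c_mem j)).derivWithin (p.uniqueDiffOn _ (p.c_mem j))).symm

theorem solution_taylor {q k : ℕ} (hq : 1 ≤ q + k) (hqk : q + k ≤ r + 1) {t : ℝ} (ht : t ∈ p.I) :
    ‖iteratedDerivWithin k p.y p.I t
        - ∑ ℓ ∈ Finset.range q, ((t - p.t₀) ^ ℓ / (ℓ ! : ℝ)) • p.yd (ℓ + k)‖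
      ≤ M * |t - p.t₀| ^ q := by
  have := taylor_remainder_le (convex_Icc p.ta p.tf) p.t₀_mem (C := M) (n := q)
    (f := fun ℓ t => iteratedDerivWithin (ℓ + k) p.y p.I t) (fun ℓ hℓ t ht => ?_)
    (fun t ht => p.sol.bound_y t ht _ (Finset.mem_Icc.2 ⟨hq, hqk⟩)) ht
  · simpa using this
  · have := hasDerivWithinAt_iteratedDerivWithin p.uniqueDiffOn p.sol.contDiffOn_y
      (k := ℓ + k) (by omega) ht
    rwa [add_right_comm] at this

/-- The expansion of the defect of a quadrature formula. -/
theorem unifO_quadrature {q : ℕ} (hq : q ≤ r) (a : Fin s → ℝ) (c : ℝ)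
    (hc : ∀ p : StepData.{u} m L M K r, p.t₀ + c * p.h ∈ p.I) :
    UnifO (h := fun p : StepData.{u} m L M K r => p.h) (q + 1) (F := fun p => p.E) fun p =>
      (p.y (p.t₀ + c * p.h) - p.y p.t₀ - p.h • ∑ j, a j • p.field j)
        - ∑ ℓ ∈ Finset.range q, (p.h ^ (ℓ + 1) * (c ^ (ℓ + 1) / ((ℓ + 1)! : ℝ)
            - (∑ j, a j * m.c j ^ ℓ) / (ℓ ! : ℝ))) • p.yd (ℓ + 1) := by
  have h0 : ∀ p : StepData.{u} m L M K r, 0 ≤ p.h := fun p => p.h_nonneg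
  have e1 : UnifO (h := fun p : StepData.{u} m L M K r => p.h) (q + 1) (F := fun p => p.E) fun p =>
      p.y (p.t₀ + c * p.h)
        - ∑ k ∈ Finset.range (q + 1), ((c * p.h) ^ k / (k ! : ℝ)) • p.yd k := by
    refine UnifO.of_bound h0 (M * |c| ^ (q + 1)) fun p => ?_
    have := p.solution_taylor (q := q + 1) (k := 0) (by omega) (by omega) (hc p)
    rw [add_sub_cancel_left, abs_mul, abs_of_nonneg p.h_nonneg, mul_pow, ← mul_assoc] at this
    simpa using this
  have e2 : ∀ j, UnifO (h := fun p : StepData.{u} m L M K r => p.h) q (F := fun p => p.E) fun p =>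
      p.field j - ∑ ℓ ∈ Finset.range q, ((m.c j * p.h) ^ ℓ / (ℓ ! : ℝ)) • p.yd (ℓ + 1) := by
    intro j
    refine UnifO.of_bound h0 (M * |m.c j| ^ q) fun p => ?_
    have := p.solution_taylor (q := q) (k := 1) (by omega) (by omega) (p.c_mem j)
    rw [add_sub_cancel_left, abs_mul, abs_of_nonneg p.h_nonneg, mul_pow, ← mul_assoc,
      ← field_eq] at this
    exact this
  -- The factor $h$ supplies the missing order: $y'$ is needed to order `q` only, while $y$ was
  -- expanded to order `q + 1`.
  have e3 := (UnifO.sum Finset.univ fun j _ => (e2 j).const_smul (a j)).smul h0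
  refine (e1.sub e3).congr fun p => ?_
  have h1 : ∑ k ∈ Finset.range (q + 1), ((c * p.h) ^ k / (k ! : ℝ)) • p.yd k
      = ∑ ℓ ∈ Finset.range q, (p.h ^ (ℓ + 1) * (c ^ (ℓ + 1) / ((ℓ + 1)! : ℝ))) • p.yd (ℓ + 1)
        + p.y p.t₀ := by
    rw [Finset.sum_range_succ']
    congr 1
    · refine Finset.sum_congr rfl fun ℓ _ => ?_
      rw [mul_pow]; congr 1; ring
    · rw [pow_zero, Nat.factorial_zero, Nat.cast_one, div_one, one_smul, yd,
        iteratedDerivWithin_zero]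
  have h2 : p.h • ∑ j, a j • (p.field j
        - ∑ ℓ ∈ Finset.range q, ((m.c j * p.h) ^ ℓ / (ℓ ! : ℝ)) • p.yd (ℓ + 1))
      = p.h • ∑ j, a j • p.field j - ∑ ℓ ∈ Finset.range q,
          (p.h ^ (ℓ + 1) * ((∑ j, a j * m.c j ^ ℓ) / (ℓ ! : ℝ))) • p.yd (ℓ + 1) := by
    simp only [smul_sub, Finset.sum_sub_distrib]
    congr 1
    simp only [Finset.smul_sum, smul_smul]
    rw [Finset.sum_comm]
    refine Finset.sum_congr rfl fun ℓ _ => ?_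
    rw [← Finset.sum_smul]
    congr 1
    rw [Finset.sum_div, Finset.mul_sum]
    refine Finset.sum_congr rfl fun j _ => ?_
    rw [mul_pow]; ring
  rw [h1, h2]
  simp only [mul_sub, sub_smul, Finset.sum_sub_distrib]
  abel

theorem unifO_defect {q : ℕ} (hq : q ≤ r) :
    UnifO (h := fun p : StepData.{u} m L M K r => p.h) (q + 1) (F := fun p => Stages s p.E)
      fun p => p.defect - ∑ ℓ ∈ Finset.range q,
        p.h ^ (ℓ + 1) • kronVec (m.stageResidual (ℓ + 1)) (p.yd (ℓ + 1)) := by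
  refine UnifO.of_stages fun i => ?_
  refine (unifO_quadrature hq (m.A i) (m.c i) fun p => p.c_mem i).congr fun p => ?_
  simp [defect, exactStages, RKMethod.stageResidual, smul_smul]

theorem unifO_stepDefect {q : ℕ} (hq : q ≤ r) :
    UnifO (h := fun p : StepData.{u} m L M K r => p.h) (q + 1) (F := fun p => p.E)
      fun p => p.stepDefect - ∑ ℓ ∈ Finset.range q,
        (p.h ^ (ℓ + 1) * m.stepResidual (ℓ + 1)) • p.yd (ℓ + 1) := by
  refine (unifO_quadrature hq m.b 1 fun p => by rw [one_mul]; exact p.h_mem).congr fun p => ?_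
  simp [stepDefect, RKMethod.stepResidual]

/-! #### The error equations -/

theorem error_equation :
    p.δ = resolvent m p.Z (p.defect + p.h • kron m.A LinearMap.id p.Δ) := by
  symm
  rw [resolvent_apply_eq_iff p.unit]
  have hY := (isStageSolution_iff m p.J p.g p.h (p.y p.t₀) p.Y).1 p.stage
  rw [δ, map_sub, hY, Δ, map_sub, smul_sub]
  have hX : (1 - kron m.A (p.h • p.J)) p.X = p.defect + kronVec 1 (p.y p.t₀)
      + p.h • kron m.A LinearMap.id (mapStages p.g p.X) := by
    ext i
    simp only [LinearMap.sub_apply, Module.End.one_apply, PiLp.sub_apply, kron_apply,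
      LinearMap.smul_apply, PiLp.add_apply, kronVec_apply, Pi.one_apply, one_smul,
      PiLp.smul_apply, LinearMap.id_apply, mapStages_apply, defect, field, smul_add,
      Finset.sum_add_distrib]
    rw [show ∑ j, m.A i j • p.h • p.J (p.X j) = p.h • ∑ j, m.A i j • p.J (p.X j) by
      rw [Finset.smul_sum]; exact Finset.sum_congr rfl fun j _ => smul_comm _ _ _]
    abel
  rw [hX]
  abel

theorem step_error_equation :
    p.y (p.t₀ + p.h) - rkStep m p.J p.g p.h (p.y p.t₀) p.Y
      = p.stepDefect + kronRow m.b p.Z p.δ + p.h • kronRow m.b LinearMap.id p.Δ := by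
  simp only [rkStep, stepDefect, kronRow_apply, δ, Δ, field, mapStages_apply,
    LinearMap.id_apply, LinearMap.smul_apply, map_sub, smul_sub, smul_add, Finset.sum_add_distrib]
  have : ∀ U : Stages s p.E, ∑ j, m.b j • p.h • p.J (U j) = p.h • ∑ j, m.b j • p.J (U j) :=
    fun U => by
      rw [Finset.smul_sum]; exact Finset.sum_congr rfl fun j _ => smul_comm _ _ _
  rw [this, this]
  abel

/-- With $V=(I-A\otimes Z)^{-1}U$, the resolvent commutes with $A\otimes I$, and $U=V-(A\otimes
Z)V$, so the terms with $b^TA\otimes Z$ cancel. The two places where $\Delta$ enters the local error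
thereby merge into the form of $\psi_\tau$ for trees with branches. -/
theorem kronRow_resolvent (U : Stages s p.E) :
    kronRow m.b p.Z (resolvent m p.Z (kron m.A LinearMap.id U)) + kronRow m.b LinearMap.id U
      = kronRow m.b LinearMap.id (resolvent m p.Z U) := by
  obtain ⟨V, hV⟩ : ∃ V, V = resolvent m p.Z U := ⟨_, rfl⟩
  have hU := (resolvent_apply_eq_iff p.unit _ _).1 hV.symm
  have hA : resolvent m p.Z (kron m.A LinearMap.id U) = kron m.A LinearMap.id V := by
    rw [resolvent_apply_eq_iff p.unit, ← hU, LinearMap.sub_apply, LinearMap.sub_apply, map_sub]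
    congr 1
    ext i
    simp [Finset.smul_sum]
  rw [hA, ← hV, ← hU]
  have hz : kronRow m.b p.Z (kron m.A LinearMap.id V)
      = kronRow m.b LinearMap.id (kron m.A p.Z V) := by
    simp [kronRow_apply]
  rw [hz, LinearMap.sub_apply, map_sub]
  simp

theorem norm_Δ_le (hL : 0 ≤ L) : ‖p.Δ‖ ≤ s * L * ‖p.δ‖ :=
  norm_mapStages_sub_le hL p.sol.lipschitz _ _

/-- In the error equation the Lipschitz term is at most $\tfrac12\|\delta\|$ by the restriction on
the step size, and it is absorbed on the left; hence the factor two. -/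
theorem norm_δ_le (hK : 0 ≤ K) (hL : 0 ≤ L) : ‖p.δ‖ ≤ 2 * K * ‖p.defect‖ := by
  have h1 : ‖p.δ‖ ≤ K * ‖p.defect + p.h • kron m.A LinearMap.id p.Δ‖ := by
    conv_lhs => rw [error_equation]
    exact p.bound _
  have h2 : ‖p.defect + p.h • kron m.A LinearMap.id p.Δ‖
      ≤ ‖p.defect‖ + p.h * ((∑ i, ∑ j, |m.A i j|) * (s * L * ‖p.δ‖)) := by
    refine (norm_add_le _ _).trans ?_
    rw [norm_smul, Real.norm_eq_abs, abs_of_nonneg p.h_nonneg]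
    have hS : 0 ≤ ∑ i, ∑ j, |m.A i j| :=
      Finset.sum_nonneg fun i _ => Finset.sum_nonneg fun j _ => abs_nonneg _
    have := norm_kron_id_le m.A p.Δ
    have h0 := p.h_nonneg
    gcongr
    exact this.trans (by gcongr; exact p.norm_Δ_le hL)
  have h3 := mul_le_mul_of_nonneg_left h2 hK
  have h4 := mul_le_mul_of_nonneg_right p.small (norm_nonneg p.δ)
  nlinarith

theorem unifO_δ (hK : 0 ≤ K) (hL : 0 ≤ L) :
    UnifO (h := fun p : StepData.{u} m L M K r => p.h) 1 (F := fun p => Stages s p.E)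
      fun p => p.δ := by
  have : UnifO (h := fun p : StepData.{u} m L M K r => p.h) 1 (F := fun p => Stages s p.E)
      fun p => p.defect := (unifO_defect (Nat.zero_le r)).congr fun p => by simp
  exact this.of_le (by positivity) fun p => p.norm_δ_le hK hL

end StepData

theorem kron_mul_id {s : ℕ} {E : Type u} [NormedAddCommGroup E] [InnerProductSpace ℝ E]
    (A B : Matrix (Fin s) (Fin s) ℝ) (U : Stages s E) :
    kron (A * B) LinearMap.id U = kron A LinearMap.id (kron B LinearMap.id U) := by
  ext i
  simp only [kron_apply, LinearMap.id_apply, Matrix.mul_apply, Finset.smul_sum, Finset.sum_smul,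
    smul_smul]
  rw [Finset.sum_comm]

theorem kron_diagonal_pow_apply {s : ℕ} {E : Type u} [NormedAddCommGroup E]
    [InnerProductSpace ℝ E] (c : Fin s → ℝ) (ℓ : ℕ) (U : Stages s E) (i : Fin s) :
    kron (Matrix.diagonal c ^ ℓ) LinearMap.id U i = c i ^ ℓ • U i := by
  rw [kron_apply, Matrix.diagonal_pow, Finset.sum_eq_single i]
  · simp
  · intro j _ hj; simp [Matrix.diagonal_apply_ne _ hj.symm]
  · simp

/-! ### Elementary differentials and their uniform bounds. -/

namespace StepData

open RTree

variable {s : ℕ} {m : RKMethod s} {L M K : ℝ} {r : ℕ} (p : StepData.{u} m L M K r)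

/-- The derivatives of the nonlinearity along the solution, at the beginning of the step. -/
abbrev G (ℓ k : ℕ) : p.E [×k]→L[ℝ] p.E := gDeriv p.g p.I p.y ℓ k p.t₀

/-- The contribution of a tree to the difference of the nonlinearities. -/
def Γ (τ : RTree) : Stages s p.E :=
  kron (Matrix.diagonal m.c ^ τ.leafCount) LinearMap.id
    (gDerivStages p.g p.I p.y τ.leafCount τ.branchList.length p.t₀ fun j =>
      p.Ψ (τ.branchList.get j))

/-- The truncated expansion of the stage error. -/
def S (q : ℕ) : Stages s p.E := ∑ τ ∈ upTo q, (τ.zeta * p.h ^ τ.order) • p.Ψ τ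

theorem Γ_apply (τ : RTree) (i : Fin s) : p.Γ τ i = m.c i ^ τ.leafCount •
    p.G τ.leafCount τ.branchList.length fun j => p.Ψ (τ.branchList.get j) i :=
  kron_diagonal_pow_apply _ _ _ _

theorem Ψ_of_branches_eq_zero {τ : RTree} (h : τ.branches = 0) : p.Ψ τ =
    resolvent m p.Z (kronVec (m.stageResidual (τ.leafCount + 1)) (p.yd (τ.leafCount + 1))) := by
  rw [Ψ, stagePsi, if_pos h]

theorem Ψ_of_branches_ne_zero {τ : RTree} (h : τ.branches ≠ 0) :
    p.Ψ τ = resolvent m p.Z (kron m.A LinearMap.id (p.Γ τ)) := by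
  rw [Ψ, stagePsi, if_neg h, kron_mul_id]
  rfl

theorem psi_of_branches_eq_zero {τ : RTree} (h : τ.branches = 0) :
    psi m p.g p.I p.y p.Z p.t₀ τ =
      m.stepResidual (τ.leafCount + 1) • p.yd (τ.leafCount + 1) + kronRow m.b p.Z (p.Ψ τ) := by
  rw [psi, if_pos h]

theorem psi_of_branches_ne_zero {τ : RTree} (h : τ.branches ≠ 0) :
    psi m p.g p.I p.y p.Z p.t₀ τ = kronRow m.b LinearMap.id (resolvent m p.Z (p.Γ τ)) := by
  rw [psi, if_neg h]
  rfl

/-- Here $\sigma_1=c-A\mathbb 1=0$. This is what permits only branches different from the one-vertex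
tree in the standardized form. -/
theorem Ψ_leaf : p.Ψ leaf = 0 := by
  rw [Ψ_of_branches_eq_zero p branches_leaf, leafCount_leaf]
  have : kronVec (m.stageResidual (0 + 1)) (p.yd (0 + 1)) = (0 : Stages s p.E) := by
    ext i
    simp [RKMethod.stageResidual, RKMethod.c]
  rw [this, map_zero]

theorem norm_G_le {ℓ k : ℕ} (hk : 1 ≤ k) (h : ℓ + k ≤ r) :
    ‖p.G ℓ k‖ ≤ ℓ ! * M * max 1 M ^ ℓ :=
  norm_gDeriv_le p.sol.contDiff_g p.sol.contDiffOn_y p.uniqueDiffOn p.sol.bound_g p.sol.bound_y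
    hk h p.t₀_mem

theorem unifO_G {ℓ k : ℕ} (hk : 1 ≤ k) (h : ℓ + k ≤ r)
    {v : ∀ p : StepData.{u} m L M K r, Fin k → p.E}
    (hv : ∀ j, UnifO (fun p : StepData.{u} m L M K r => p.h) 0 (F := fun p => p.E) fun p => v p j) :
    UnifO (fun p : StepData.{u} m L M K r => p.h) 0 (F := fun p => p.E) fun p => p.G ℓ k (v p) := by
  choose C hC H using hv
  refine UnifO.of_bound (fun p => p.h_nonneg) ((ℓ ! * M * max 1 M ^ ℓ) * ∏ j, C j) fun p => ?_
  rw [pow_zero, mul_one]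
  refine ((p.G ℓ k).le_opNorm _).trans ?_
  refine mul_le_mul (p.norm_G_le hk h) ?_ (Finset.prod_nonneg fun j _ => norm_nonneg _)
    ((norm_nonneg _).trans (p.norm_G_le hk h))
  exact Finset.prod_le_prod (fun j _ => norm_nonneg _) fun j _ => by simpa using H j p

theorem unifO_Γ (τ : RTree) (hτ : τ.order ≤ r) (hb : τ.branches ≠ 0)
    (ih : ∀ σ ∈ τ.branches,
      UnifO (fun p : StepData.{u} m L M K r => p.h) 0 (F := fun p => Stages s p.E) fun p => p.Ψ σ) :
    UnifO (fun p : StepData.{u} m L M K r => p.h) 0 (F := fun p => Stages s p.E)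
      fun p => p.Γ τ := by
  refine UnifO.of_stages fun i => ?_
  have h1 := order_eq τ
  have h2 := card_le_sum_order τ.branches
  have h3 := Multiset.card_pos.2 hb
  have hlen := SemilinearRK.RTree.length_branchList τ
  refine ((unifO_G (ℓ := τ.leafCount) (k := τ.branchList.length) (by omega) (by omega)
    (v := fun p j => p.Ψ (τ.branchList.get j) i) fun j => (ih _ ?_).stage i).const_smul
      (m.c i ^ τ.leafCount)).congr fun p => (p.Γ_apply τ i).symm
  exact Multiset.mem_toList.1 (List.get_mem _ j)

theorem unifO_resolvent (hK : 0 ≤ K) {n : ℕ} {U : ∀ p : StepData.{u} m L M K r, Stages s p.E}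
    (hU : UnifO (fun p : StepData.{u} m L M K r => p.h) n (F := fun p => Stages s p.E) U) :
    UnifO (fun p : StepData.{u} m L M K r => p.h) n (F := fun p => Stages s p.E)
      fun p => resolvent m p.Z (U p) :=
  hU.of_le hK fun p => p.bound _

theorem unifO_kronRow_resolvent (hK : 0 ≤ K) {n : ℕ}
    {U : ∀ p : StepData.{u} m L M K r, Stages s p.E}
    (hU : UnifO (fun p : StepData.{u} m L M K r => p.h) n (F := fun p => Stages s p.E) U) :
    UnifO (fun p : StepData.{u} m L M K r => p.h) n (F := fun p => p.E)
      fun p => kronRow m.b p.Z (resolvent m p.Z (U p)) :=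
  hU.of_le hK fun p => p.bound' _

theorem unifO_kron {n : ℕ} (B : Matrix (Fin s) (Fin s) ℝ)
    {U : ∀ p : StepData.{u} m L M K r, Stages s p.E}
    (hU : UnifO (fun p : StepData.{u} m L M K r => p.h) n (F := fun p => Stages s p.E) U) :
    UnifO (fun p : StepData.{u} m L M K r => p.h) n (F := fun p => Stages s p.E)
      fun p => kron B LinearMap.id (U p) :=
  hU.of_le (Finset.sum_nonneg fun _ _ => Finset.sum_nonneg fun _ _ => abs_nonneg _)
    fun _ => norm_kron_id_le B _

theorem unifO_kronRow {n : ℕ} (β : Fin s → ℝ)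
    {U : ∀ p : StepData.{u} m L M K r, Stages s p.E}
    (hU : UnifO (fun p : StepData.{u} m L M K r => p.h) n (F := fun p => Stages s p.E) U) :
    UnifO (fun p : StepData.{u} m L M K r => p.h) n (F := fun p => p.E)
      fun p => kronRow β LinearMap.id (U p) :=
  hU.of_le (Finset.sum_nonneg fun _ _ => abs_nonneg _) fun _ => norm_kronRow_id_le β _

theorem unifO_Ψ (hK : 0 ≤ K) (τ : RTree) (hτ : τ.order ≤ r) :
    UnifO (fun p : StepData.{u} m L M K r => p.h) 0 (F := fun p => Stages s p.E)
      fun p => p.Ψ τ := by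
  induction hn : τ.order using Nat.strong_induction_on generalizing τ with
  | _ n ih =>
    by_cases hb : τ.branches = 0
    · have h1 := order_eq τ
      refine UnifO.congr (unifO_resolvent hK (n := 0)
        (U := fun p => kronVec (m.stageResidual (τ.leafCount + 1)) (p.yd (τ.leafCount + 1))) ?_)
        fun p => (p.Ψ_of_branches_eq_zero hb).symm
      refine UnifO.of_stages fun i => ?_
      refine UnifO.congr (UnifO.const_smul (f := fun p => p.yd (τ.leafCount + 1)) ?_
        (m.stageResidual (τ.leafCount + 1) i)) fun p => (kronVec_apply _ _ i).symm
      refine UnifO.of_bound (fun p => p.h_nonneg) M fun p => ?_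
      rw [pow_zero, mul_one]
      exact p.sol.bound_y p.t₀ p.t₀_mem _ (Finset.mem_Icc.2 ⟨by omega, by omega⟩)
    · refine UnifO.congr (unifO_resolvent hK (unifO_kron m.A (unifO_Γ τ hτ hb fun σ hσ => ?_)))
        fun p => (p.Ψ_of_branches_ne_zero hb).symm
      have := order_lt_of_mem_branches hσ
      exact ih σ.order (by omega) σ (by omega) rfl

/-! #### Expansion of the nonlinearity -/

/-- Expansion of $g(Y)=g(X-\delta)$ about the exact stage: the sign of the displacement and that of
$-g(Y)$ give $(-1)^{k+1}$, and $\delta=O(h)$ makes the remainder $O(h^q)$. -/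
theorem unifO_taylor_Δ {q : ℕ} (hq1 : 1 ≤ q) (hq : q ≤ r)
    (hδ : UnifO (fun p : StepData.{u} m L M K r => p.h) 1 (F := fun p => Stages s p.E)
      fun p => p.δ) (i : Fin s) :
    UnifO (fun p : StepData.{u} m L M K r => p.h) q (F := fun p => p.E) fun p =>
      p.Δ i - ∑ k ∈ Finset.Ico 1 q, ((-1 : ℝ) ^ (k + 1) / (k ! : ℝ)) •
        iteratedFDeriv ℝ k p.g (p.X i) fun _ => p.δ i := by
  obtain ⟨C, hC, H⟩ := hδ.stage i
  refine UnifO.of_bound (fun p => p.h_nonneg) (M * C ^ q) fun p => ?_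
  have h1 := taylor_line_remainder_le p.sol.contDiff_g hq
    (fun x => p.sol.bound_g x q (Finset.mem_Icc.2 ⟨hq1, hq⟩)) (p.X i) (-p.δ i)
  have h2 : p.X i + -p.δ i = p.Y i := by simp [δ]
  have h3 : ∀ k, iteratedFDeriv ℝ k p.g (p.X i) (fun _ => -p.δ i)
      = (-1 : ℝ) ^ k • iteratedFDeriv ℝ k p.g (p.X i) (fun _ => p.δ i) := fun k => by
    have := (iteratedFDeriv ℝ k p.g (p.X i)).map_smul_univ (fun _ => (-1 : ℝ)) (fun _ => p.δ i)
    simpa using this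
  rw [h2, Finset.range_eq_Ico, Finset.sum_eq_sum_Ico_succ_bot (by omega)] at h1
  have h4 : p.Δ i - ∑ k ∈ Finset.Ico 1 q, ((-1 : ℝ) ^ (k + 1) / (k ! : ℝ)) •
        iteratedFDeriv ℝ k p.g (p.X i) (fun _ => p.δ i)
      = -(p.g (p.Y i) - ((1 / (0 ! : ℝ)) • iteratedFDeriv ℝ 0 p.g (p.X i) (fun _ => -p.δ i)
        + ∑ k ∈ Finset.Ico (0 + 1) q, (1 / (k ! : ℝ)) •
          iteratedFDeriv ℝ k p.g (p.X i) (fun _ => -p.δ i))) := by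
    simp only [h3, smul_smul]
    have h5 : p.Δ i = p.g (p.X i) - p.g (p.Y i) := rfl
    have h6 : ∑ k ∈ Finset.Ico 1 q, ((-1 : ℝ) ^ (k + 1) / (k ! : ℝ)) •
        iteratedFDeriv ℝ k p.g (p.X i) (fun _ => p.δ i)
        = -∑ k ∈ Finset.Ico 1 q, (1 / (k ! : ℝ) * (-1) ^ k) •
          iteratedFDeriv ℝ k p.g (p.X i) (fun _ => p.δ i) := by
      rw [← Finset.sum_neg_distrib]
      refine Finset.sum_congr rfl fun k _ => ?_
      rw [← neg_smul]; congr 1; ring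
    rw [h5, h6]
    simp
    abel
  rw [h4, norm_neg]
  refine h1.trans ?_
  rw [norm_neg, mul_assoc, ← mul_pow]
  refine mul_le_mul_of_nonneg_left ?_ p.M_nonneg
  have := H p
  rw [pow_one] at this
  exact pow_le_pow_left₀ (norm_nonneg _) this q

/-- A bounded multilinear map is Lipschitz on bounded sets; this lets the unknown $\delta$ be
replaced by its truncated expansion. -/
theorem unifO_derivative_sub {k q : ℕ} (hk : 1 ≤ k) (hkr : k ≤ r) {i : Fin s}
    {a b : ∀ p : StepData.{u} m L M K r, p.E}
    (ha : UnifO (fun p : StepData.{u} m L M K r => p.h) 0 (F := fun p => p.E) a)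
    (hb : UnifO (fun p : StepData.{u} m L M K r => p.h) 0 (F := fun p => p.E) b)
    (hab : UnifO (fun p : StepData.{u} m L M K r => p.h) q (F := fun p => p.E)
      fun p => a p - b p) :
    UnifO (fun p : StepData.{u} m L M K r => p.h) q (F := fun p => p.E) fun p =>
      iteratedFDeriv ℝ k p.g (p.X i) (fun _ => a p)
        - iteratedFDeriv ℝ k p.g (p.X i) (fun _ => b p) := by
  obtain ⟨A, hA, HA⟩ := ha
  obtain ⟨B, hB, HB⟩ := hb
  obtain ⟨C, hC, HC⟩ := hab
  refine UnifO.of_bound (fun p => p.h_nonneg) (M * k * max A B ^ (k - 1) * C) fun p => ?_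
  refine ((iteratedFDeriv ℝ k p.g (p.X i)).norm_image_sub_le _ _).trans ?_
  have hM := p.sol.bound_g (p.X i) k (Finset.mem_Icc.2 ⟨hk, hkr⟩)
  have h1 : ‖fun _ : Fin k => a p‖ ≤ A := (pi_norm_const_le _).trans (by simpa using HA p)
  have h2 : ‖fun _ : Fin k => b p‖ ≤ B := (pi_norm_const_le _).trans (by simpa using HB p)
  have h3 : ‖(fun _ : Fin k => a p) - fun _ => b p‖ ≤ C * p.h ^ q :=
    (pi_norm_const_le (a p - b p)).trans (HC p)
  have hM0 := p.M_nonneg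
  rw [Fintype.card_fin, mul_assoc _ C]
  gcongr

/-- The $k$ arguments already contribute $h^k$, so the time expansion of $g^{(k)}(y(t))$ may stop
after $n$ terms. No more than $n+k\le r$ derivatives of $g$ are used. -/
theorem unifO_time_taylor {k n : ℕ} (hk : 1 ≤ k) (hn : n + k ≤ r) {i : Fin s}
    {a : ∀ p : StepData.{u} m L M K r, p.E}
    (ha : UnifO (fun p : StepData.{u} m L M K r => p.h) 1 (F := fun p => p.E) a) :
    UnifO (fun p : StepData.{u} m L M K r => p.h) (n + k) (F := fun p => p.E) fun p =>
      iteratedFDeriv ℝ k p.g (p.X i) (fun _ => a p)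
        - ∑ ℓ ∈ Finset.range n, ((m.c i * p.h) ^ ℓ / (ℓ ! : ℝ)) • p.G ℓ k fun _ => a p := by
  obtain ⟨A, hA, HA⟩ := ha
  refine UnifO.of_bound (fun p => p.h_nonneg)
    ((n ! * M * max 1 M ^ n) * |m.c i| ^ n * A ^ k) fun p => ?_
  have hcd := contDiffOn_iteratedFDeriv_comp p.sol.contDiff_g p.sol.contDiffOn_y hn
  have h1 := taylor_remainder_le (convex_Icc p.ta p.tf) p.t₀_mem
    (C := n ! * M * max 1 M ^ n) (n := n)
    (f := fun ℓ t => gDeriv p.g p.I p.y ℓ k t)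
    (fun ℓ hℓ t ht => hasDerivWithinAt_iteratedDerivWithin p.uniqueDiffOn hcd hℓ ht)
    (fun t ht => norm_gDeriv_le p.sol.contDiff_g p.sol.contDiffOn_y p.uniqueDiffOn p.sol.bound_g
      p.sol.bound_y hk hn ht) (p.c_mem i)
  rw [add_sub_cancel_left, abs_mul, abs_of_nonneg p.h_nonneg, mul_pow, ← mul_assoc] at h1
  have h2 : gDeriv p.g p.I p.y 0 k (p.t₀ + m.c i * p.h) = iteratedFDeriv ℝ k p.g (p.X i) := by
    rw [gDeriv, iteratedDerivWithin_zero]; rfl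
  rw [h2] at h1
  have h3 := (iteratedFDeriv ℝ k p.g (p.X i) - ∑ ℓ ∈ Finset.range n,
    ((m.c i * p.h) ^ ℓ / (ℓ ! : ℝ)) • p.G ℓ k).le_opNorm (fun _ => a p)
  have h4 : ‖a p‖ ^ k ≤ A ^ k * p.h ^ k := by
    rw [← mul_pow]
    have := HA p
    rw [pow_one] at this
    exact pow_le_pow_left₀ (norm_nonneg _) this k
  simp only [sub_apply, sum_apply, smul_apply, Finset.prod_const, Finset.card_univ,
    Fintype.card_fin] at h3
  refine h3.trans ((mul_le_mul h1 h4 (pow_nonneg (norm_nonneg _) k)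
    ((norm_nonneg _).trans h1)).trans (le_of_eq ?_))
  rw [pow_add]; ring

/-- The term of a sequence of branches in the expansion of the nonlinearity. -/
def seqTerm (i : Fin s) (ℓ k : ℕ) (f : Fin k → RTree) : p.E :=
  (p.h ^ seqOrder ℓ k f * m.c i ^ ℓ) • p.G ℓ k fun j => p.Ψ (f j) i

theorem seqTerm_eq_of_map_eq {q ℓ k : ℕ} (hq : q ≤ r) {i : Fin s} {τ : RTree} (hτ : τ.order ≤ q)
    {f : Fin k → RTree}
    (hf : (Finset.univ : Finset (Fin k)).val.map f = τ.branches) (hℓ : τ.leafCount = ℓ) :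
    p.seqTerm i ℓ k f = p.h ^ τ.order • p.Γ τ i := by
  have hk : k = τ.branchList.length := by
    rw [SemilinearRK.RTree.length_branchList, ← hf]; simp
  subst hk hℓ
  rw [seqTerm, seqOrder_eq rfl hf, Γ_apply, smul_smul]
  congr 1
  obtain ⟨σ, rfl⟩ := exists_perm_of_map_univ_eq
    (hf.trans (SemilinearRK.RTree.map_get_branchList τ).symm)
  have h1 := order_eq τ
  have h2 := card_le_sum_order τ.branches
  have h3 := SemilinearRK.RTree.length_branchList τ
  exact gDeriv_comp_perm p.sol.contDiff_g p.sol.contDiffOn_y p.uniqueDiffOn (by omega) p.t₀_mem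
    (fun j => p.Ψ (τ.branchList.get j) i) σ

theorem seqTerm_eq_zero {ℓ k : ℕ} {i : Fin s} {f : Fin k → RTree} (hf : ∃ j, f j = leaf) :
    p.seqTerm i ℓ k f = 0 := by
  obtain ⟨j, hj⟩ := hf
  rw [seqTerm, ContinuousMultilinearMap.map_coord_zero _ j, smul_zero]
  rw [hj, Ψ_leaf]; rfl

/-- Expanding the multilinear map at the sum `S q` in every slot gives one term per sequence of
trees; collecting powers of $h$ yields `seqOrder`. -/
theorem sum_seqTerm (i : Fin s) (q ℓ k : ℕ) :
    ∑ f ∈ Fintype.piFinset fun _ : Fin k => upTo q, seqCoeff ℓ k f • p.seqTerm i ℓ k f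
      = (p.h * ((-1 : ℝ) ^ (k + 1) / (k ! : ℝ) * ((m.c i * p.h) ^ ℓ / (ℓ ! : ℝ)))) •
        p.G ℓ k fun _ => p.S q i := by
  have hS : p.S q i = ∑ τ ∈ upTo q, (τ.zeta * p.h ^ τ.order) • p.Ψ τ i := by
    simp [S]
  rw [hS, ContinuousMultilinearMap.map_sum_finset, Finset.smul_sum]
  refine Finset.sum_congr rfl fun f _ => ?_
  have := (p.G ℓ k).map_smul_univ (fun j => (f j).zeta * p.h ^ (f j).order) (fun j => p.Ψ (f j) i)
  rw [this, seqTerm, smul_smul, smul_smul, Finset.prod_mul_distrib, Finset.prod_pow_eq_pow_sum,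
    seqCoeff, seqOrder]
  congr 1
  field_simp
  ring

-- The bootstrapping step: an expansion of $\delta$ with error $O(h^q)$ determines $h\Delta$ with
-- error $O(h^{q+1})$, the extra order being the factor $h$.
open Classical in
theorem unifO_expansion (hK : 0 ≤ K) {q : ℕ} (hq1 : 1 ≤ q) (hq : q ≤ r)
    (hδ : UnifO (fun p : StepData.{u} m L M K r => p.h) 1 (F := fun p => Stages s p.E)
      fun p => p.δ)
    (hS : UnifO (fun p : StepData.{u} m L M K r => p.h) q (F := fun p => Stages s p.E)
      fun p => p.δ - p.S (q - 1)) :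
    UnifO (fun p : StepData.{u} m L M K r => p.h) (q + 1) (F := fun p => Stages s p.E) fun p =>
      p.h • p.Δ - ∑ τ ∈ upTo q with τ.branches ≠ 0, (τ.zeta * p.h ^ τ.order) • p.Γ τ := by
  have h0 : ∀ p : StepData.{u} m L M K r, 0 ≤ p.h := fun p => p.h_nonneg
  have h1 : ∀ p : StepData.{u} m L M K r, p.h ≤ 1 := fun p => p.h_le_one
  refine UnifO.of_stages fun i => ?_
  have hδi := hδ.stage i
  have hSδi : UnifO (fun p : StepData.{u} m L M K r => p.h) q (F := fun p => p.E)
      fun p => p.δ i - p.S (q - 1) i := hS.stage i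
  have hSi : UnifO (fun p : StepData.{u} m L M K r => p.h) 1 (F := fun p => p.E)
      fun p => p.S (q - 1) i :=
    (hδi.sub (hSδi.mono h0 h1 hq1)).congr fun p => sub_sub_cancel _ _
  have e1 : UnifO (fun p : StepData.{u} m L M K r => p.h) q (F := fun p => p.E) fun p =>
      p.Δ i - ∑ k ∈ Finset.Ico 1 q, ((-1 : ℝ) ^ (k + 1) / (k ! : ℝ)) •
        ∑ ℓ ∈ Finset.range (q - k), ((m.c i * p.h) ^ ℓ / (ℓ ! : ℝ)) •
          p.G ℓ k fun _ => p.S (q - 1) i := by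
    -- For each $k$ two errors are made: $\delta$ is replaced by `S (q - 1)`, and $g^{(k)}$ at the
    -- exact stage by its time expansion with $q-k$ terms.
    have e2 := UnifO.sum (Finset.Ico 1 q) (h := fun p : StepData.{u} m L M K r => p.h) (n := q)
      (F := fun p => p.E)
      (f := fun k p => ((-1 : ℝ) ^ (k + 1) / (k ! : ℝ)) •
        ((iteratedFDeriv ℝ k p.g (p.X i) (fun _ => p.δ i)
          - iteratedFDeriv ℝ k p.g (p.X i) (fun _ => p.S (q - 1) i))
        + (iteratedFDeriv ℝ k p.g (p.X i) (fun _ => p.S (q - 1) i)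
          - ∑ ℓ ∈ Finset.range (q - k), ((m.c i * p.h) ^ ℓ / (ℓ ! : ℝ)) •
            p.G ℓ k fun _ => p.S (q - 1) i))) fun k hk => by
        rw [Finset.mem_Ico] at hk
        refine UnifO.const_smul (UnifO.add ?_ ?_) _
        · exact unifO_derivative_sub hk.1 (by omega) (hδi.mono h0 h1 zero_le_one)
            (hSi.mono h0 h1 zero_le_one) hSδi
        · have := unifO_time_taylor (i := i) (k := k) (n := q - k) hk.1 (by omega) hSi
          rwa [Nat.sub_add_cancel hk.2.le] at this
    refine ((unifO_taylor_Δ hq1 hq hδ i).add e2).congr fun p => ?_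
    simp only [sub_add_sub_cancel, smul_sub, Finset.sum_sub_distrib]
  -- The product of truncated sums also contains terms of order above `q`; each is $h^{q+1}$ or
  -- smaller times a bounded quantity and joins the error.
  have e3 : UnifO (fun p : StepData.{u} m L M K r => p.h) (q + 1) (F := fun p => p.E) fun p =>
      ∑ k ∈ Finset.Ico 1 q, ∑ ℓ ∈ Finset.range (q - k),
        ∑ f ∈ (Fintype.piFinset fun _ : Fin k => upTo (q - 1)) with ¬ seqOrder ℓ k f ≤ q,
          seqCoeff ℓ k f • p.seqTerm i ℓ k f := by
    refine UnifO.sum _ fun k hk => UnifO.sum _ fun ℓ hℓ => UnifO.sum _ fun f hf =>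
      UnifO.const_smul (f := fun p : StepData.{u} m L M K r => p.seqTerm i ℓ k f) ?_ _
    rw [Finset.mem_Ico] at hk
    rw [Finset.mem_range] at hℓ
    simp only [Finset.mem_filter, Fintype.mem_piFinset, mem_upTo] at hf
    have e4 := unifO_G (L := L) (M := M) (K := K) (m := m) (v := fun p j => p.Ψ (f j) i)
      hk.1 (by omega : ℓ + k ≤ r)
      fun j => (unifO_Ψ hK (f j) (by have := hf.1 j; omega)).stage i
    refine UnifO.mono h0 h1 (n := 0 + seqOrder ℓ k f) ?_ (by omega)
    refine ((e4.const_smul (m.c i ^ ℓ)).pow_smul h0 (seqOrder ℓ k f)).congr fun p => ?_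
    rw [seqTerm, smul_smul]
  refine ((e1.smul h0).add e3).congr fun p => ?_
  have e5 : (∑ τ ∈ upTo q with τ.branches ≠ 0, (τ.zeta * p.h ^ τ.order) • p.Γ τ) i
      = ∑ k ∈ Finset.Ico 1 q, ∑ ℓ ∈ Finset.range (q - k),
        ∑ f ∈ (Fintype.piFinset fun _ : Fin k => upTo (q - 1)) with seqOrder ℓ k f ≤ q,
          seqCoeff ℓ k f • p.seqTerm i ℓ k f := by
    have : (∑ τ ∈ upTo q with τ.branches ≠ 0, (τ.zeta * p.h ^ τ.order) • p.Γ τ) i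
        = ∑ τ ∈ upTo q with τ.branches ≠ 0, τ.zeta • (p.h ^ τ.order • p.Γ τ i) := by
      simp [smul_smul]
    rw [this, ← sum_trees_by_shape]
    refine Finset.sum_congr rfl fun k hk => Finset.sum_congr rfl fun ℓ hℓ => ?_
    rw [Finset.mem_Ico] at hk
    symm
    refine sum_seq_eq_sum_trees hk.1 _ _ (fun τ f hτ hf hℓ => p.seqTerm_eq_of_map_eq hq hτ hf hℓ)
      fun f hf => p.seqTerm_eq_zero hf
  have e6 : p.h • ∑ k ∈ Finset.Ico 1 q, ((-1 : ℝ) ^ (k + 1) / (k ! : ℝ)) •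
        ∑ ℓ ∈ Finset.range (q - k), ((m.c i * p.h) ^ ℓ / (ℓ ! : ℝ)) •
          p.G ℓ k (fun _ => p.S (q - 1) i)
      = ∑ k ∈ Finset.Ico 1 q, ∑ ℓ ∈ Finset.range (q - k),
          ∑ f ∈ Fintype.piFinset fun _ : Fin k => upTo (q - 1),
            seqCoeff ℓ k f • p.seqTerm i ℓ k f := by
    simp only [sum_seqTerm, Finset.smul_sum, smul_smul]
  rw [smul_sub, e6, PiLp.sub_apply, PiLp.smul_apply, e5, sub_add]
  congr 1
  simp only [← Finset.sum_sub_distrib]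
  refine Finset.sum_congr rfl fun k _ => Finset.sum_congr rfl fun ℓ _ => ?_
  rw [← Finset.sum_filter_add_sum_filter_not (Fintype.piFinset fun _ : Fin k => upTo (q - 1))
    (fun f => seqOrder ℓ k f ≤ q), add_sub_cancel_right]

/-! ### Expansions of the stage error and of the local error. -/

theorem unifO_nonlinearity_zero (hK : 0 ≤ K) (hL : 0 ≤ L) :
    UnifO (fun p : StepData.{u} m L M K r => p.h) 1 (F := fun p => Stages s p.E)
      fun p => p.h • p.Δ :=
  (((unifO_δ hK hL).of_le (mul_nonneg (Nat.cast_nonneg s) hL) fun p => p.norm_Δ_le hL).smul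
    fun p => p.h_nonneg).mono (fun p => p.h_nonneg) (fun p => p.h_le_one) one_le_two

-- An exact identity: applying the resolvent to the partial sums for the defect and for $h\Delta$
-- reproduces the recursion of $\Psi_\tau$, so the error of the stage expansion is linear in the
-- errors of these two.
open Classical in
theorem δ_sub_S (q : ℕ) : p.δ - p.S q = resolvent m p.Z
    ((p.defect - ∑ ℓ ∈ Finset.range q,
        p.h ^ (ℓ + 1) • kronVec (m.stageResidual (ℓ + 1)) (p.yd (ℓ + 1)))
      + kron m.A LinearMap.id (p.h • p.Δ
        - ∑ τ ∈ upTo q with τ.branches ≠ 0, (τ.zeta * p.h ^ τ.order) • p.Γ τ)) := by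
  have hS : p.S q = resolvent m p.Z (∑ ℓ ∈ Finset.range q,
        p.h ^ (ℓ + 1) • kronVec (m.stageResidual (ℓ + 1)) (p.yd (ℓ + 1))
      + kron m.A LinearMap.id
        (∑ τ ∈ upTo q with τ.branches ≠ 0, (τ.zeta * p.h ^ τ.order) • p.Γ τ)) := by
    rw [S, sum_trees_eq q p.h p.Ψ (fun ℓ => resolvent m p.Z
      (kronVec (m.stageResidual (ℓ + 1)) (p.yd (ℓ + 1)))) fun τ hτ => p.Ψ_of_branches_eq_zero hτ]
    simp only [map_add, map_sum, map_smul]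
    congr 1
    refine Finset.sum_congr rfl fun τ hτ => ?_
    rw [Ψ_of_branches_ne_zero p (Finset.mem_filter.1 hτ).2]
  rw [error_equation, hS, ← map_sub, map_sub (kron m.A LinearMap.id), map_smul]
  congr 1
  abel

/-- The expansion of the stage error. -/
theorem unifO_δ_sub_S (hK : 0 ≤ K) (hL : 0 ≤ L) {q : ℕ} (hq : q ≤ r) :
    UnifO (fun p : StepData.{u} m L M K r => p.h) (q + 1) (F := fun p => Stages s p.E)
      fun p => p.δ - p.S q := by
  induction q with
  | zero =>
    refine (unifO_δ hK hL).congr fun p => ?_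
    rw [S, upTo_zero, Finset.sum_empty, sub_zero]
  | succ q ih =>
    -- The expansion of $\delta$ through order `q` feeds that of $h\Delta$ through order `q + 1`,
    -- and the uniformly bounded resolvent loses nothing.
    exact (unifO_resolvent hK ((unifO_defect hq).add (unifO_kron m.A
      (unifO_expansion hK (by omega) hq (unifO_δ hK hL) (ih (by omega)))))).congr
        fun p => (p.δ_sub_S (q + 1)).symm

-- For trees without branches, $Z$ is applied only behind the resolvent, where $(b^T\otimes
-- Z)(I-A\otimes Z)^{-1}$ is bounded. The contributions of $\Delta$ are merged by
-- `kronRow_resolvent`.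
open Classical in
theorem step_error_sub (q : ℕ) :
    (p.y (p.t₀ + p.h) - rkStep m p.J p.g p.h (p.y p.t₀) p.Y)
        - ∑ τ ∈ upTo q, (τ.zeta * p.h ^ τ.order) • psi m p.g p.I p.y p.Z p.t₀ τ
      = (p.stepDefect - ∑ ℓ ∈ Finset.range q,
          (p.h ^ (ℓ + 1) * m.stepResidual (ℓ + 1)) • p.yd (ℓ + 1))
        + kronRow m.b p.Z (resolvent m p.Z (p.defect - ∑ ℓ ∈ Finset.range q,
          p.h ^ (ℓ + 1) • kronVec (m.stageResidual (ℓ + 1)) (p.yd (ℓ + 1))))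
        + kronRow m.b LinearMap.id (resolvent m p.Z (p.h • p.Δ
          - ∑ τ ∈ upTo q with τ.branches ≠ 0, (τ.zeta * p.h ^ τ.order) • p.Γ τ)) := by
  have h1 : ∑ τ ∈ upTo q, (τ.zeta * p.h ^ τ.order) • psi m p.g p.I p.y p.Z p.t₀ τ
      = ∑ ℓ ∈ Finset.range q, (p.h ^ (ℓ + 1) * m.stepResidual (ℓ + 1)) • p.yd (ℓ + 1)
        + kronRow m.b p.Z (resolvent m p.Z (∑ ℓ ∈ Finset.range q,
          p.h ^ (ℓ + 1) • kronVec (m.stageResidual (ℓ + 1)) (p.yd (ℓ + 1))))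
        + kronRow m.b LinearMap.id (resolvent m p.Z
          (∑ τ ∈ upTo q with τ.branches ≠ 0, (τ.zeta * p.h ^ τ.order) • p.Γ τ)) := by
    rw [sum_trees_eq q p.h (psi m p.g p.I p.y p.Z p.t₀) (fun ℓ =>
      m.stepResidual (ℓ + 1) • p.yd (ℓ + 1) + kronRow m.b p.Z (resolvent m p.Z
        (kronVec (m.stageResidual (ℓ + 1)) (p.yd (ℓ + 1))))) fun τ hτ =>
      (p.psi_of_branches_eq_zero hτ).trans (by rw [p.Ψ_of_branches_eq_zero hτ])]
    simp only [map_sum, map_smul, smul_add, Finset.sum_add_distrib, smul_smul]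
    congr 1
    refine Finset.sum_congr rfl fun τ hτ => ?_
    rw [psi_of_branches_ne_zero p (Finset.mem_filter.1 hτ).2]
  rw [h1, step_error_equation, error_equation]
  have h2 := p.kronRow_resolvent (p.h • p.Δ)
  simp only [map_add, map_sub, map_smul] at h2 ⊢
  rw [← h2]
  abel

/-- The expansion of the local error. -/
theorem unifO_step_error_sub (hK : 0 ≤ K) (hL : 0 ≤ L) :
    UnifO (fun p : StepData.{u} m L M K r => p.h) (r + 1) (F := fun p => p.E) fun p =>
      (p.y (p.t₀ + p.h) - rkStep m p.J p.g p.h (p.y p.t₀) p.Y)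
        - ∑ τ ∈ upTo r, (τ.zeta * p.h ^ τ.order) • psi m p.g p.I p.y p.Z p.t₀ τ := by
  classical
  have hexp : UnifO (fun p : StepData.{u} m L M K r => p.h) (r + 1)
      (F := fun p => Stages s p.E) fun p => p.h • p.Δ
        - ∑ τ ∈ upTo r with τ.branches ≠ 0, (τ.zeta * p.h ^ τ.order) • p.Γ τ := by
    -- For `r = 0` no derivative of $g$ is bounded by assumption, and the expansion lemma does not
    -- apply; the tree sum is empty and the Lipschitz condition suffices.
    rcases Nat.eq_zero_or_pos r with rfl | hr
    · refine (unifO_nonlinearity_zero hK hL).congr fun p => ?_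
      rw [upTo_zero, Finset.filter_empty, Finset.sum_empty, sub_zero]
    · refine unifO_expansion hK hr le_rfl (unifO_δ hK hL) ?_
      have := unifO_δ_sub_S (m := m) (M := M) (r := r) hK hL (Nat.sub_le r 1)
      rwa [Nat.sub_add_cancel hr] at this
  refine (((unifO_stepDefect le_rfl).add (unifO_kronRow_resolvent hK (unifO_defect le_rfl))).add
    (unifO_kronRow m.b (unifO_resolvent hK hexp))).congr fun p => (p.step_error_sub r).symm

end StepData

/-- For a step of size zero all errors and all terms of the expansions vanish. -/
theorem errors_of_step_zero {s : ℕ} {m : RKMethod s} {E : Type u} [NormedAddCommGroup E]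
    [InnerProductSpace ℝ E] {J : E →ₗ[ℝ] E} {g : E → E} {y : ℝ → E} {t₀ : ℝ} {Y : Stages s E}
    (hY : IsStageSolution m J g 0 (y t₀) Y) :
    exactStages m y t₀ 0 - Y = 0 ∧ y (t₀ + 0) - rkStep m J g 0 (y t₀) Y = 0 := by
  constructor
  · ext i
    have := hY i
    rw [zero_smul, add_zero] at this
    simp [exactStages, this]
  · simp [rkStep]

theorem sum_trees_step_zero {V : Type v} [AddCommGroup V] [Module ℝ V] (r : ℕ) (F : RTree → V) :
    ∑ τ ∈ RTree.upTo r, (τ.zeta * (0 : ℝ) ^ τ.order) • F τ = 0 :=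
  Finset.sum_eq_zero fun τ _ => by
    have := RTree.one_le_order τ
    rw [zero_pow (by omega), mul_zero, zero_smul]

end SemilinearRK

end

/-! ### Choice of the constants and proof of the theorem. -/

open SemilinearRK
theorem theorem3p2 {s : ℕ} (m : RKMethod s) (hAS : m.IsASStable) (hASI : m.IsASIStable)
    (L : ℝ) (hL : 0 < L) :
    -- the bound on the step size depends on the method and on `L` only
    ∃ hmax : ℝ, 0 < hmax ∧ ∀ (r : ℕ) (M : ℝ),
      -- the constant depends on the method, `L`, `r` and `M` only
      ∃ D : ℝ, ∀ (E : Type*) [NormedAddCommGroup E] [InnerProductSpace ℝ E]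
        [FiniteDimensional ℝ E] (J : E →ₗ[ℝ] E) (g : E → E) (y : ℝ → E) (ta tf t₀ h : ℝ),
        IsSemilinearSolution r L M J g (Set.Icc ta tf) y →
        t₀ ∈ Set.Icc ta tf → 0 ≤ h → h < hmax → t₀ + h ∈ Set.Icc ta tf →
        (∀ i, t₀ + m.c i * h ∈ Set.Icc ta tf) →
        IsUnit (1 - kron m.A (h • J)) ∧
        (∃! Y : Stages s E, IsStageSolution m J g h (y t₀) Y) ∧
        ∀ Y : Stages s E, IsStageSolution m J g h (y t₀) Y →
          ‖(exactStages m y t₀ h - Y) - ∑ τ ∈ RTree.upTo r,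
              (τ.zeta * h ^ τ.order) • stagePsi m g (Set.Icc ta tf) y (h • J) t₀ τ‖
            ≤ D * h ^ (r + 1) ∧
          ‖(y (t₀ + h) - rkStep m J g h (y t₀) Y) - ∑ τ ∈ RTree.upTo r,
              (τ.zeta * h ^ τ.order) • psi m g (Set.Icc ta tf) y (h • J) t₀ τ‖
            ≤ D * h ^ (r + 1) := by
  obtain ⟨K, hK, hres⟩ := RKMethod.exists_resolvent_bound hAS hASI
  set B := K * (∑ i, ∑ j, |m.A i j|) * (s * L) with hB
  have hB0 : 0 ≤ B := by
    have : 0 ≤ ∑ i, ∑ j, |m.A i j| :=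
      Finset.sum_nonneg fun i _ => Finset.sum_nonneg fun j _ => abs_nonneg _
    positivity
  -- The second entry ensures $hB\le\tfrac12$, for contraction and absorption; adding one to `B`
  -- guards against $B=0$. The bound by one lets higher powers of $h$ be estimated by lower ones.
  refine ⟨min 1 (1 / (2 * (B + 1))), by positivity, fun r M => ?_⟩
  obtain ⟨C₁, hC₁, H₁⟩ := StepData.unifO_δ_sub_S (m := m) (M := M) (r := r) hK hL.le le_rfl
  obtain ⟨C₂, hC₂, H₂⟩ := StepData.unifO_step_error_sub (m := m) (M := M) (r := r) hK hL.le
  refine ⟨C₁ + C₂, fun E _ _ _ J g y ta tf t₀ h sol ht₀ hh hlt hmem cmem => ?_⟩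
  have hsmall : h * B ≤ 1 / 2 := by
    have h1 := (hlt.trans_le (min_le_right _ _)).le
    rw [le_div_iff₀ (by positivity)] at h1
    nlinarith
  obtain ⟨hunit, hbound⟩ := hres E (h • J)
    ((dissipative_of_logNorm_nonpos sol.logNorm_nonpos).smul hh)
  refine ⟨hunit, existsUnique_stages hh hK hL.le hunit (fun U => (hbound U).1) sol.lipschitz
    (lt_of_le_of_lt hsmall (by norm_num)) _, fun Y hY => ?_⟩
  -- For $h=0$ the interval may be a single point, where derivatives within it are not unique; but
  -- every error and every term of the expansions vanishes.
  rcases hh.eq_or_lt with rfl | hpos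
  · obtain ⟨e₁, e₂⟩ := errors_of_step_zero hY
    rw [e₁, e₂, sum_trees_step_zero, sum_trees_step_zero]
    simp
  · let p : StepData m L M K r :=
      { E := E, J := J, g := g, y := y, ta := ta, tf := tf, t₀ := t₀, h := h, Y := Y
        sol := sol
        t₀_mem := ht₀
        h_pos := hpos
        h_le_one := (hlt.trans_le (min_le_left _ _)).le
        small := hsmall
        h_mem := hmem
        c_mem := cmem
        stage := hY
        unit := hunit
        bound := fun U => (hbound U).1
        bound' := fun U => (hbound U).2 }
    have hp := pow_nonneg hh (r + 1)
    exact ⟨(H₁ p).trans (mul_le_mul_of_nonneg_right (le_add_of_nonneg_right hC₂) hp),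
      (H₂ p).trans (mul_le_mul_of_nonneg_right (le_add_of_nonneg_left hC₁) hp)⟩
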